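/- Let $k$ be an algebraically closed field, $Q=\mathbb P^1\times\mathbb P^1$ over $k$, and let $S=k[x_0,x_1,y_0,y_1]$ be its bigraded coordinate ring, with $\deg x_i=(1,0)$ and $\deg y_j=(0,1)$. A $(1,0)$-line (respectively $(0,1)$-line) is the zero locus of a nonzero form of bidegree $(1,0)$ (respectively $(0,1)$). For a zero-dimensional closed subscheme $X\subset Q$, not necessarily reduced, let $I(X)\subset S$ be its saturated bihomogeneous ideal, let $M_X(i,j)=\dim_k (S/I(X))_{i,j}$ for $i,j\ge 0$ and $M_X(i,j)=0$ otherwise, and let $$\Delta M_X(i,j)=M_X(i,j)-M_X(i-1,j)-M_X(i,j-1)+M_X(i-1,j-1).$$ Put $a=\min\{i\in\mathbb N: I(X)_{i,0}\ne 0\}-1$ and $b=\min\{j\in\mathbb N: I(X)_{0,j}\neq 0\}-1$. For a line $L$ with equation $l$ let $\#(X\cap L)$ be the degree of the scheme defined by the saturation of $(I(X),l)$. Write $I(X)=\bigcap_{P'\in X}J_{P'}$, where $J_{P'}$ is the component of $I(X)$ at the point $P'$, and let $I_P$ be the bihomogeneous prime ideal of a point $P$. Let $P\in X$ be a point at which $X$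 has multiplicity one, that is, the local ring $\mathcal O_{X,P}$ has length $1$. Let $R$ be the $(1,0)$-line and $C$ the $(0,1)$-line through $P$, so that $P=R\cap C$. Let $Z=X\setminus\{P\}$, the (possibly empty) scheme with ideal $I(Z)=\bigcap_{P'\in X,\,P'\ne P}J_{P'}$, and let $p=\#(Z\cap R)$ and $q=\#(Z\cap C)$. Suppose that one of the following conditions holds: 1. $p=b$; 2. $q=a$; 3. $p<b$, $q<a$ and $\Delta M_X(i,j)=0$ for all $(i,j)$ with $i\ge q+1$ and $j\ge p+1$. Then $\Delta M_Z(i,j)=\Delta M_X(i,j)$ for all $(i,j)\neq(q,p)$, and $\Delta M_Z(q,p)=\Delta M_X(q,p)-1$. Moreover, call a form $f\in S$ a separator for $P\in X$ if $f(P)\ne 0$ and $f\in\bigcap_{P'\in X,\,P'\ne P}J_{P'}$. Then $P$ has a separator of bidegree $(q,p)$; every separator of bidegree $(i,j)$ for $P$ satisfies $i\ge q$ and $j\ge p$; and any two separators $f,g$ of bidegree $(q,p)$ satisfy $f-cg\in I(X)$ for some nonzero $c\in k$. -/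

import Mathlib

noncomputable section

namespace BiProj

/-- The coordinate ring `S = k[x₀, x₁, y₀, y₁]` of `ℙ¹ × ℙ¹`: `x i = X (inl i)`, `y j = X (inr j)`. -/
abbrev S (k : Type*) [Field k] : Type _ := MvPolynomial (Fin 2 ⊕ Fin 2) k

/-- The bidegrees of the variables: `x i` has bidegree `(1,0)` and `y j` has bidegree `(0,1)`. -/
def wt : Fin 2 ⊕ Fin 2 → ℕ × ℕ := Sum.elim (fun _ => (1, 0)) (fun _ => (0, 1))

/-- The bigrading of `S`: `bigrading k (i, j)` is the space `S_{i,j} = H⁰(𝒪(i,j))` of forms of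
bidegree `(i, j)`. -/
abbrev bigrading (k : Type*) [Field k] : ℕ × ℕ → Submodule k (S k) :=
  MvPolynomial.weightedHomogeneousSubmodule k wt

instance gradedAlgebra (k : Type*) [Field k] : GradedAlgebra (bigrading k) :=
  MvPolynomial.weightedGradedAlgebra k wt

/-- The closed points of `ℙ¹ × ℙ¹`. -/
abbrev Point (k : Type*) [Field k] : Type _ :=
  Projectivization k (Fin 2 → k) × Projectivization k (Fin 2 → k)

/-- The parametrisation `(s, t) ↦ (s u, t v)` of the cone over the point `P = ([u], [v])`,
on coordinate rings. -/
def coneMap {k : Type*} [Field k] (P : Point k) : S k →ₐ[k] MvPolynomial (Fin 2) k :=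
  MvPolynomial.aeval (Sum.elim
    (fun i => MvPolynomial.C (P.1.rep i) * MvPolynomial.X 0)
    (fun j => MvPolynomial.C (P.2.rep j) * MvPolynomial.X 1))

/-- The bihomogeneous prime ideal `I_P` of a point `P`: the polynomials that vanish on the cone
over `P`. A form `f` satisfies `f(P) ≠ 0` if and only if `f ∉ I_P`. -/
def pointIdeal {k : Type*} [Field k] (P : Point k) : Ideal (S k) :=
  RingHom.ker (coneMap P)

instance pointIdeal_isPrime {k : Type*} [Field k] (P : Point k) : (pointIdeal P).IsPrime :=
  RingHom.ker_isPrime _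

/-- The irrelevant ideal `(x₀, x₁) ∩ (y₀, y₁)`, generated by the products `x i * y j`. -/
def irrelevant (k : Type*) [Field k] : Ideal (S k) :=
  Ideal.span (Set.range fun ij : Fin 2 × Fin 2 =>
    (MvPolynomial.X (Sum.inl ij.1) * MvPolynomial.X (Sum.inr ij.2) : S k))

/-- The saturation `sat J` of `J` with respect to the irrelevant ideal. -/
def saturation {k : Type*} [Field k] (J : Ideal (S k)) : Ideal (S k) where
  carrier := {f | ∃ n : ℕ, ∀ g ∈ irrelevant k ^ n, g * f ∈ J}
  zero_mem' := ⟨0, fun g _ => by simp⟩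
  add_mem' := by
    rintro f f' ⟨n, hn⟩ ⟨m, hm⟩
    refine ⟨n + m, fun g hg => ?_⟩
    rw [mul_add]
    exact J.add_mem (hn g (Ideal.pow_le_pow_right (Nat.le_add_right n m) hg))
      (hm g (Ideal.pow_le_pow_right (Nat.le_add_left m n) hg))
  smul_mem' := by
    rintro c f ⟨n, hn⟩
    refine ⟨n, fun g hg => ?_⟩
    rw [smul_eq_mul, mul_left_comm]
    exact J.mul_mem_left c (hn g hg)

/-- The points at which every element of `I` vanishes. -/
def support {k : Type*} [Field k] (I : Ideal (S k)) : Set (Point k) :=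
  {P | I ≤ pointIdeal P}

/-- A zero-dimensional (or empty) closed subscheme of `ℙ¹ × ℙ¹` over an algebraically closed field,
given by its saturated bihomogeneous ideal. It need not be reduced. -/
structure ZeroDimScheme (k : Type*) [Field k] where
  ideal : Ideal (S k)
  homogeneous : ideal.IsHomogeneous (bigrading k)
  saturated : saturation ideal ≤ ideal
  finite_support : (support ideal).Finite

/-- The Hilbert function `M(i,j) = dim_k (S/I)_{i,j}`, extended by zero to negative degrees. -/
def hilbert {k : Type*} [Field k] (I : Ideal (S k)) (i j : ℤ) : ℤ :=
  if 0 ≤ i ∧ 0 ≤ j then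
    (Module.finrank k
      ((bigrading k (i.toNat, j.toNat)).map (Ideal.Quotient.mkₐ k I).toLinearMap) : ℤ)
  else 0

/-- The first difference of the Hilbert function. -/
def diffHilbert {k : Type*} [Field k] (I : Ideal (S k)) (i j : ℤ) : ℤ :=
  hilbert I i j - hilbert I (i - 1) j - hilbert I i (j - 1) + hilbert I (i - 1) (j - 1)

/-- The degree of the zero-dimensional scheme defined by `I`: the value `M(i,j)` for `i, j ≫ 0`. -/
def degree {k : Type*} [Field k] (I : Ideal (S k)) : ℕ :=
  sInf {d : ℕ | ∃ n : ℤ, ∀ i j : ℤ, n ≤ i → n ≤ j → hilbert I i j = d}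

/-- `#(X ∩ L)`: the number of points, counted with multiplicity, of the scheme defined by `I` on
the line with equation `l`, that is, the degree of `sat (I, l)`. -/
def numOnLine {k : Type*} [Field k] (I : Ideal (S k)) (l : S k) : ℕ :=
  degree (saturation (I ⊔ Ideal.span {l}))

/-- The local ring of `ℙ¹ × ℙ¹` at `P`: fractions `f / g` of forms of equal bidegree,
with `g(P) ≠ 0`. -/
abbrev LocalRing {k : Type*} [Field k] (P : Point k) : Type _ :=
  HomogeneousLocalization.AtPrime (bigrading k) (pointIdeal P)

/-- The stalk at `P` of the ideal sheaf of the scheme defined by `I`. -/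
def stalkIdeal {k : Type*} [Field k] (I : Ideal (S k)) (P : Point k) : Ideal (LocalRing P) :=
  (I.map (algebraMap (S k) (Localization.AtPrime (pointIdeal P)))).comap
    (algebraMap (LocalRing P) (Localization.AtPrime (pointIdeal P)))

/-- The multiplicity `m_X(P)` of the scheme `X` defined by `I`: the length of `𝒪_{X,P}`. -/
def multiplicity {k : Type*} [Field k] (I : Ideal (S k)) (P : Point k) : ℕ∞ :=
  Module.length (LocalRing P ⧸ stalkIdeal I P) (LocalRing P ⧸ stalkIdeal I P)

/-- The component `J_P` of a bihomogeneous ideal `I` at `P`: the elements that belong to `I` after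
multiplication by a form not vanishing at `P`. -/
def component {k : Type*} [Field k] (I : Ideal (S k)) (P : Point k) : Ideal (S k) where
  carrier := {f | ∃ d : ℕ × ℕ, ∃ s ∈ bigrading k d, s ∉ pointIdeal P ∧ s * f ∈ I}
  zero_mem' := ⟨0, 1, SetLike.GradedOne.one_mem,
    (Ideal.ne_top_iff_one _).1 (pointIdeal_isPrime P).ne_top, by simp⟩
  add_mem' := by
    rintro f f' ⟨d, s, hs, hsP, hsf⟩ ⟨d', s', hs', hsP', hsf'⟩
    refine ⟨d + d', s * s', SetLike.GradedMul.mul_mem hs hs',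
      fun h => ((pointIdeal_isPrime P).mem_or_mem h).elim hsP hsP', ?_⟩
    have e : s * s' * (f + f') = s' * (s * f) + s * (s' * f') := by ring
    rw [e]
    exact I.add_mem (I.mul_mem_left _ hsf) (I.mul_mem_left _ hsf')
  smul_mem' := by
    rintro c f ⟨d, s, hs, hsP, hsf⟩
    refine ⟨d, s, hs, hsP, ?_⟩
    rw [smul_eq_mul, mul_left_comm]
    exact I.mul_mem_left c hsf

/-- The ideal `⋂_{P' ∈ X, P' ≠ P} J_{P'}`. -/
def eraseIdeal {k : Type*} [Field k] (I : Ideal (S k)) (P : Point k) : Ideal (S k) :=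
  ⨅ P' : {P' : Point k // P' ∈ support I ∧ P' ≠ P}, component I P'.1

theorem le_component {k : Type*} [Field k] (I : Ideal (S k)) (P : Point k) :
    I ≤ component I P := fun f hf =>
  ⟨0, 1, SetLike.GradedOne.one_mem,
    (Ideal.ne_top_iff_one _).1 (pointIdeal_isPrime P).ne_top, by simpa using hf⟩

theorem component_homogeneous {k : Type*} [Field k] {I : Ideal (S k)}
    (hI : I.IsHomogeneous (bigrading k)) (P : Point k) :
    (component I P).IsHomogeneous (bigrading k) := by
  rintro e f ⟨d, s, hs, hsP, hsf⟩
  refine ⟨d, s, hs, hsP, ?_⟩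
  have h := hI (d + e) hsf
  rwa [DirectSum.coe_decompose_mul_add_of_left_mem (bigrading k) hs] at h

theorem exists_mul_notMem {k : Type*} [Field k] (P : Point k) : ∃ i j : Fin 2,
    (MvPolynomial.X (Sum.inl i) * MvPolynomial.X (Sum.inr j) : S k) ∉ pointIdeal P := by
  obtain ⟨i, hi⟩ := Function.ne_iff.1 P.1.rep_nonzero
  obtain ⟨j, hj⟩ := Function.ne_iff.1 P.2.rep_nonzero
  refine ⟨i, j, fun h => ?_⟩
  have h' : coneMap P (MvPolynomial.X (Sum.inl i) * MvPolynomial.X (Sum.inr j)) = 0 := h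
  simp only [Pi.zero_apply] at hi hj
  simp [coneMap, hi, hj] at h'

theorem component_saturated {k : Type*} [Field k] (I : Ideal (S k)) (P : Point k) :
    saturation (component I P) ≤ component I P := by
  rintro f ⟨n, hn⟩
  obtain ⟨i, j, hij⟩ := exists_mul_notMem P
  obtain ⟨d, s, hs, hsP, hsf⟩ := hn _ (Ideal.pow_mem_pow
    (Ideal.subset_span (Set.mem_range_self (i, j))) n)
  have hX : ∀ v : Fin 2 ⊕ Fin 2, (MvPolynomial.X v : S k) ∈ bigrading k (wt v) := fun v =>
    MvPolynomial.isWeightedHomogeneous_X k wt v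
  refine ⟨_, _, SetLike.GradedMul.mul_mem hs (SetLike.pow_mem_graded n
    (SetLike.GradedMul.mul_mem (hX (Sum.inl i)) (hX (Sum.inr j)))), fun h => ?_, ?_⟩
  · exact ((pointIdeal_isPrime P).mem_or_mem h).elim hsP
      fun h' => hij ((pointIdeal_isPrime P).mem_of_pow_mem n h')
  · rw [mul_assoc]
    exact hsf

theorem mem_eraseIdeal {k : Type*} [Field k] {I : Ideal (S k)} {P : Point k} {f : S k} :
    f ∈ eraseIdeal I P ↔ ∀ P' ∈ support I, P' ≠ P → f ∈ component I P' := by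
  rw [eraseIdeal, Ideal.mem_iInf]
  exact ⟨fun h P' h₁ h₂ => h ⟨P', h₁, h₂⟩, fun h P' => h P'.1 P'.2.1 P'.2.2⟩

theorem eraseIdeal_saturated {k : Type*} [Field k] (I : Ideal (S k)) (P : Point k) :
    saturation (eraseIdeal I P) ≤ eraseIdeal I P := by
  rintro f ⟨n, hn⟩
  rw [mem_eraseIdeal]
  intro P' h₁ h₂
  exact component_saturated I P' ⟨n, fun g hg => mem_eraseIdeal.1 (hn g hg) P' h₁ h₂⟩

theorem eraseIdeal_homogeneous {k : Type*} [Field k] {I : Ideal (S k)}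
    (hI : I.IsHomogeneous (bigrading k)) (P : Point k) :
    (eraseIdeal I P).IsHomogeneous (bigrading k) :=
  Ideal.IsHomogeneous.iInf (𝒜 := bigrading k) fun P' => component_homogeneous hI P'.1

theorem le_eraseIdeal {k : Type*} [Field k] (I : Ideal (S k)) (P : Point k) :
    I ≤ eraseIdeal I P := fun _ hf =>
  mem_eraseIdeal.2 fun P' _ _ => le_component I P' hf

/-- The subscheme `X ∖ {P}`: all the components of `X` supported at points other than `P`. -/
def ZeroDimScheme.erase {k : Type*} [Field k] (X : ZeroDimScheme k) (P : Point k) :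
    ZeroDimScheme k where
  ideal := eraseIdeal X.ideal P
  homogeneous := eraseIdeal_homogeneous X.homogeneous P
  saturated := eraseIdeal_saturated X.ideal P
  finite_support := X.finite_support.subset fun _ hQ => (le_eraseIdeal X.ideal P).trans hQ

/-- The Hilbert function `M_X`. -/
def ZeroDimScheme.M {k : Type*} [Field k] (X : ZeroDimScheme k) : ℤ → ℤ → ℤ := hilbert X.ideal

/-- The first difference `ΔM_X`. -/
def ZeroDimScheme.ΔM {k : Type*} [Field k] (X : ZeroDimScheme k) : ℤ → ℤ → ℤ :=
  diffHilbert X.ideal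

/-- `a = min {i | I(X)_{i,0} ≠ 0} - 1`. -/
def ZeroDimScheme.a {k : Type*} [Field k] (X : ZeroDimScheme k) : ℤ :=
  (sInf {i : ℕ | ∃ f ∈ X.ideal, f ∈ bigrading k (i, 0) ∧ f ≠ 0} : ℕ) - 1

/-- `b = min {j | I(X)_{0,j} ≠ 0} - 1`. -/
def ZeroDimScheme.b {k : Type*} [Field k] (X : ZeroDimScheme k) : ℤ :=
  (sInf {j : ℕ | ∃ f ∈ X.ideal, f ∈ bigrading k (0, j) ∧ f ≠ 0} : ℕ) - 1

/-- `f` is a separator of bidegree `(i, j)` for `P ∈ X`: a form of that bidegree with `f(P) ≠ 0`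
that lies in the components of `X` at all the points other than `P`. -/
def ZeroDimScheme.IsSeparator {k : Type*} [Field k] (X : ZeroDimScheme k) (P : Point k)
    (i j : ℕ) (f : S k) : Prop :=
  f ∈ bigrading k (i, j) ∧ f ∉ pointIdeal P ∧
    ∀ P' ∈ support X.ideal, P' ≠ P → f ∈ component X.ideal P'

end BiProj

end

noncomputable section

namespace BiProj

/-! ### Forms, points and saturated ideals on the product of two projective lines. -/

section

open MvPolynomial

variable {k : Type*} [Field k]

/-! Since `P` has multiplicity one, `I(X)` and `I(Z) ∩ I_P` contain the same forms
(`mem_ideal_iff_of_multiplicity_one`). Hence `M_X - M_Z` at `(i, j)` is 1 if `P` has a separator of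
bidegree `(i, j)` and 0 otherwise. If separators occur exactly in the bidegrees with `i ≥ q` and `j
≥ p`, this difference is the indicator of a quadrant, and its mixed difference is 1 at the corner
`(q, p)` and 0 elsewhere. Uniqueness has the same source: a combination of two separators that
cancels at `P` lies in `I(Z) ∩ I_P`.

To find the bidegrees of separators, choose two lines at infinity that miss the support, and put `P`
at the origin of the affine plane that remains (`exists_chart`). Forms of bidegree `(i, j)` become
polynomials of degree at most `i` in `s` and `j` in `t`, and `I(Z)` becomes an ideal `K` of `k[s,
t]`. On the line `s = 0` the ideal `K` restricts to `(w)` with `deg w = p` and `w(0) ≠ 0`. A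
separator restricts to a nonzero multiple of `w`, so its `t`-degree is at least `p`; conversely some
separator has `t`-degree at most `p` (`hasSep_of_line`). Exchanging `s` and `t` gives the same for
`q`.

It remains to pass from separators of bidegrees `(q, j)` and `(i, p)` to one of bidegree `(q, p)`.
If `p = b`, a polynomial in `t` alone of degree at most `p + 1` lies in `I(X)`, and the remainder on
division by it has `t`-degree at most `p` (`HasSep.of_dvd`); `q = a` is symmetric. In the third
case, a missing separator at `(q, p)` would force an inner corner in the staircase of separators.
There `ΔM_X = ΔM_Z - 1`, while `ΔM_Z ≤ 0` because `I(Z)` has a nonzero form in that bidegree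
(`boxHilbert_diff_le_zero`), contradicting the vanishing of `ΔM_X` (`hasSep_of_diff_eq_zero`). -/

theorem aeval_mul_of_mem {B : Type*} [CommRing B] [Algebra k B] {i j : ℕ} {f : S k}
    (hf : f ∈ bigrading k (i, j)) (g h : Fin 2 → B) (a b : B) :
    aeval (Sum.elim (fun n => a * g n) (fun n => b * h n)) f =
      a ^ i * b ^ j * aeval (Sum.elim g h) f := by
  rw [aeval_def, aeval_def, eval₂_eq', eval₂_eq', Finset.mul_sum]
  refine Finset.sum_congr rfl fun d hd => ?_
  have hw := hf (mem_support_iff.1 hd)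
  have h1 : d (Sum.inl 0) + d (Sum.inl 1) = i ∧ d (Sum.inr 0) + d (Sum.inr 1) = j := by
    rw [Finsupp.weight_apply, Finsupp.sum_fintype _ _ (by simp)] at hw
    simpa [Fintype.sum_sum_type, wt, Prod.ext_iff] using hw
  obtain ⟨rfl, rfl⟩ := h1
  simp only [Fintype.prod_sum_type, Fin.prod_univ_two, Sum.elim_inl, Sum.elim_inr]
  ring

/-- The value of a polynomial at the representative of a point. -/
def evalAt (P : Point k) : S k →ₐ[k] k := aeval (Sum.elim P.1.rep P.2.rep)

theorem mem_pointIdeal_iff {P : Point k} {d : ℕ × ℕ} {f : S k} (hf : f ∈ bigrading k d) :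
    f ∈ pointIdeal P ↔ evalAt P f = 0 := by
  obtain ⟨i, j⟩ := d
  have h := aeval_mul_of_mem (B := MvPolynomial (Fin 2) k) hf
    (fun n => C (P.1.rep n)) (fun n => C (P.2.rep n)) (X 0) (X 1)
  have h1 : coneMap P f = X 0 ^ i * X 1 ^ j * C (evalAt P f) := by
    rw [coneMap]
    simp only [mul_comm (C _)]
    rw [h, evalAt, ← MvPolynomial.algebraMap_eq, ← aeval_algebraMap_apply]
    congr 2
    ext (n | n) <;> simp
  rw [pointIdeal, RingHom.mem_ker]
  rw [show (coneMap P) f = _ from h1]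
  simp [X_ne_zero]

theorem sum_decompose (f : S k) : ∃ s : Finset (ℕ × ℕ),
    f = ∑ d ∈ s, (DirectSum.decompose (bigrading k) f d : S k) := by
  classical
  exact ⟨_, (DirectSum.sum_support_decompose (bigrading k) f).symm⟩

theorem decompose_mem (f : S k) (d : ℕ × ℕ) :
    (DirectSum.decompose (bigrading k) f d : S k) ∈ bigrading k d :=
  (DirectSum.decompose (bigrading k) f d).2

theorem le_of_forms {I J : Ideal (S k)} (hI : I.IsHomogeneous (bigrading k))
    (h : ∀ d, ∀ f ∈ bigrading k d, f ∈ I → f ∈ J) : I ≤ J := by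
  intro f hf
  obtain ⟨s, hs⟩ := sum_decompose f
  rw [hs]
  exact J.sum_mem fun d _ => h d _ (decompose_mem f d) (hI d hf)

theorem exists_form_notMem {I J : Ideal (S k)} (hI : I.IsHomogeneous (bigrading k))
    (h : ¬ I ≤ J) : ∃ d, ∃ f ∈ bigrading k d, f ∈ I ∧ f ∉ J := by
  by_contra! hc
  exact h (le_of_forms hI hc)

theorem le_saturation (J : Ideal (S k)) : J ≤ saturation J := fun _ hf =>
  ⟨0, fun g _ => J.mul_mem_left g hf⟩

theorem mul_mem_bigrading {i j i' j' : ℕ} {f g : S k} (hf : f ∈ bigrading k (i, j))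
    (hg : g ∈ bigrading k (i', j')) : f * g ∈ bigrading k (i + i', j + j') :=
  SetLike.GradedMul.mul_mem (A := bigrading k) hf hg

theorem pow_mem_bigrading {i j : ℕ} {f : S k} (hf : f ∈ bigrading k (i, j)) (n : ℕ) :
    f ^ n ∈ bigrading k (n * i, n * j) :=
  SetLike.pow_mem_graded (A := bigrading k) n hf

theorem X_inl_mem (i : Fin 2) : (X (Sum.inl i) : S k) ∈ bigrading k (1, 0) :=
  isWeightedHomogeneous_X k wt (Sum.inl i)

theorem X_inr_mem (i : Fin 2) : (X (Sum.inr i) : S k) ∈ bigrading k (0, 1) :=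
  isWeightedHomogeneous_X k wt (Sum.inr i)

/-- The value of a form at a representative of a point vanishes iff the form belongs to the ideal
of the point. -/
theorem mem_pointIdeal_mk {u v : Fin 2 → k} (hu : u ≠ 0) (hv : v ≠ 0) {d : ℕ × ℕ} {f : S k}
    (hf : f ∈ bigrading k d) :
    f ∈ pointIdeal (Projectivization.mk k u hu, Projectivization.mk k v hv) ↔
      aeval (Sum.elim u v) f = 0 := by
  obtain ⟨i, j⟩ := d
  obtain ⟨a, ha⟩ := Projectivization.exists_smul_eq_mk_rep k u hu
  obtain ⟨b, hb⟩ := Projectivization.exists_smul_eq_mk_rep k v hv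
  rw [mem_pointIdeal_iff hf, evalAt]
  dsimp only
  rw [← ha, ← hb]
  have h := aeval_mul_of_mem hf u v (a : k) (b : k)
  have e : Sum.elim (a • u) (b • v) =
      Sum.elim (fun n => (a : k) * u n) (fun n => (b : k) * v n) := by
    ext (n | n) <;> simp [Units.smul_def]
  rw [e, h]
  simp

/-- The Nullstellensatz in affine 4-space: a zero of `J` at which some `x i * y j` is nonzero
represents a point of the support, so `h` times the irrelevant ideal vanishes on the zero locus of
`J`. -/
theorem pow_mem_saturation [IsAlgClosed k] {J : Ideal (S k)}
    (hJ : J.IsHomogeneous (bigrading k)) {d : ℕ × ℕ} {h : S k} (hd : h ∈ bigrading k d)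
    (hh : ∀ Q ∈ support J, h ∈ pointIdeal Q) : ∃ n : ℕ, h ^ n ∈ saturation J := by
  have key : Ideal.span {h} * irrelevant k ≤ J.radical := by
    rw [irrelevant, Ideal.span_mul_span', Ideal.span_le, ← vanishingIdeal_zeroLocus_eq_radical (K := k)]
    rintro _ ⟨g, hg, _, ⟨⟨i, j⟩, rfl⟩, rfl⟩
    obtain rfl := Set.mem_singleton_iff.1 hg
    simp only [SetLike.mem_coe, mem_vanishingIdeal_iff, mem_zeroLocus_iff]
    intro z hz
    by_contra hne
    rw [map_mul, map_mul, aeval_X, aeval_X] at hne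
    have hu : (fun n => z (Sum.inl n)) ≠ 0 := fun h0 => hne (by
      rw [show z (Sum.inl i) = 0 from congrFun h0 i]; simp)
    have hv : (fun n => z (Sum.inr n)) ≠ 0 := fun h0 => hne (by
      rw [show z (Sum.inr j) = 0 from congrFun h0 j]; simp)
    have ez : Sum.elim (fun n => z (Sum.inl n)) (fun n => z (Sum.inr n)) = z := by
      ext (n | n) <;> rfl
    have hQ := hh (Projectivization.mk k _ hu, Projectivization.mk k _ hv)
      (le_of_forms hJ fun d f hf hfJ => (mem_pointIdeal_mk hu hv hf).2 (by rw [ez]; exact hz f hfJ))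
    rw [mem_pointIdeal_mk hu hv hd, ez] at hQ
    exact hne (by rw [hQ]; simp)
  obtain ⟨n, hn⟩ := Ideal.exists_pow_le_of_le_radical_of_fg key (IsNoetherian.noetherian _)
  refine ⟨n, n, fun g hg => hn ?_⟩
  rw [mul_pow, mul_comm g]
  exact Ideal.mul_mem_mul (Ideal.pow_mem_pow (Ideal.mem_span_singleton_self h) n) hg

theorem colon_homogeneous {J : Ideal (S k)} (hJ : J.IsHomogeneous (bigrading k)) {d : ℕ × ℕ}
    {f : S k} (hf : f ∈ bigrading k d) :
    (Submodule.colon J {f}).IsHomogeneous (bigrading k) := by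
  intro e s hs
  rw [Submodule.mem_colon_singleton, smul_eq_mul] at hs ⊢
  have h := hJ (e + d) hs
  rwa [DirectSum.coe_decompose_mul_add_of_right_mem (bigrading k) hf] at h

/-- The hypothesis says that the colon ideal `(J : f)` has empty support, so its saturation contains
1. -/
theorem mem_saturation_of_local [IsAlgClosed k] {J : Ideal (S k)}
    (hJ : J.IsHomogeneous (bigrading k)) {d : ℕ × ℕ} {f : S k} (hf : f ∈ bigrading k d)
    (h : ∀ Q ∈ support J, ∃ s ∉ pointIdeal Q, s * f ∈ J) : f ∈ saturation J := by
  have hsub : J ≤ Submodule.colon J {f} := fun g hg => by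
    rw [Submodule.mem_colon_singleton, smul_eq_mul]
    exact J.mul_mem_right f hg
  obtain ⟨n, m, hm⟩ := pow_mem_saturation (colon_homogeneous hJ hf) (h := 1) (d := 0)
    SetLike.GradedOne.one_mem (fun Q hQ => by
      obtain ⟨s, hs, hsf⟩ := h Q (hsub.trans hQ)
      exact absurd (hQ (Submodule.mem_colon_singleton.2 hsf)) hs)
  refine ⟨m, fun g hg => ?_⟩
  have := hm g hg
  rwa [one_pow, mul_one, Submodule.mem_colon_singleton, smul_eq_mul] at this

theorem mem_of_forall_component [IsAlgClosed k] (X : ZeroDimScheme k) {d : ℕ × ℕ} {f : S k}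
    (hf : f ∈ bigrading k d) (h : ∀ Q ∈ support X.ideal, f ∈ component X.ideal Q) :
    f ∈ X.ideal :=
  X.saturated (mem_saturation_of_local X.homogeneous hf fun Q hQ => by
    obtain ⟨_, s, _, hs, hsf⟩ := h Q hQ
    exact ⟨s, hs, hsf⟩)

/-! ### Separating points, and forms of `I(Z)` that do not vanish at `P`. -/

/-- The equation of the line through a point of `ℙ¹`. -/
def lineForm (e : Fin 2 → k) (ι : Fin 2 → Fin 2 ⊕ Fin 2) : S k :=
  C (e 1) * X (ι 0) - C (e 0) * X (ι 1)

theorem lineForm_inl_mem (e : Fin 2 → k) : lineForm e Sum.inl ∈ bigrading k (1, 0) :=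
  Submodule.sub_mem _ (IsWeightedHomogeneous.C_mul (X_inl_mem 0) _)
    (IsWeightedHomogeneous.C_mul (X_inl_mem 1) _)

theorem lineForm_inr_mem (e : Fin 2 → k) : lineForm e Sum.inr ∈ bigrading k (0, 1) :=
  Submodule.sub_mem _ (IsWeightedHomogeneous.C_mul (X_inr_mem 0) _)
    (IsWeightedHomogeneous.C_mul (X_inr_mem 1) _)

theorem eq_of_det_eq_zero {P Q : Projectivization k (Fin 2 → k)}
    (h : P.rep 1 * Q.rep 0 - P.rep 0 * Q.rep 1 = 0) : P = Q := by
  rw [← P.mk_rep, ← Q.mk_rep, Projectivization.mk_eq_mk_iff']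
  obtain ⟨n, hn⟩ := Function.ne_iff.1 Q.rep_nonzero
  refine ⟨P.rep n / Q.rep n, ?_⟩
  simp only [Pi.zero_apply] at hn
  ext m
  simp only [Pi.smul_apply, smul_eq_mul]
  rw [div_mul_eq_mul_div, div_eq_iff hn]
  fin_cases n <;> fin_cases m <;> simp <;>
    first | ring1 | linear_combination h | linear_combination -h

theorem exists_form_separating {P Q : Point k} (h : Q ≠ P) :
    ∃ d, ∃ f ∈ bigrading k d, f ∈ pointIdeal Q ∧ f ∉ pointIdeal P := by
  by_cases h1 : Q.1 = P.1
  · have h2 : Q.2 ≠ P.2 := fun h2 => h (Prod.ext h1 h2)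
    refine ⟨_, lineForm Q.2.rep Sum.inr, lineForm_inr_mem _, ?_, ?_⟩ <;>
      rw [mem_pointIdeal_iff (lineForm_inr_mem _)]
    · simp [evalAt, lineForm]; ring
    · intro h0
      exact h2 (eq_of_det_eq_zero (by simpa [evalAt, lineForm] using h0))
  · refine ⟨_, lineForm Q.1.rep Sum.inl, lineForm_inl_mem _, ?_, ?_⟩ <;>
      rw [mem_pointIdeal_iff (lineForm_inl_mem _)]
    · simp [evalAt, lineForm]; ring
    · intro h0
      exact h1 (eq_of_det_eq_zero (by simpa [evalAt, lineForm] using h0))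

theorem prod_mem_bigrading {ι : Type*} (s : Finset ι) (d : ι → ℕ × ℕ) (f : ι → S k)
    (h : ∀ i ∈ s, f i ∈ bigrading k (d i)) : ∏ i ∈ s, f i ∈ bigrading k (∑ i ∈ s, d i) :=
  IsWeightedHomogeneous.prod s f d h

/-- Take `f` vanishing at `Q` but not at `P`, and `G` vanishing at the rest of the support but not
at `Q`. Some power of `G * f` lies in the ideal, so the same power of `f` lies in the component at
`Q`. -/
theorem component_not_le [IsAlgClosed k] (X : ZeroDimScheme k) {P Q : Point k} (h : Q ≠ P) :
    ¬ component X.ideal Q ≤ pointIdeal P := by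
  classical
  intro hle
  obtain ⟨d, f, hf, hfQ, hfP⟩ := exists_form_separating h
  have hch : ∀ Q' : Point k, ∃ e, ∃ g ∈ bigrading k e,
      Q' ≠ Q → g ∈ pointIdeal Q' ∧ g ∉ pointIdeal Q := by
    intro Q'
    by_cases hQ : Q' = Q
    · exact ⟨0, 0, Submodule.zero_mem _, fun h => absurd hQ h⟩
    · obtain ⟨e, g, hg, h1⟩ := exists_form_separating hQ
      exact ⟨e, g, hg, fun _ => h1⟩
  choose e g hg hgQ using hch
  set T := X.finite_support.toFinset.erase Q
  set G := ∏ Q' ∈ T, g Q'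
  have hG : G ∈ bigrading k (∑ Q' ∈ T, e Q') := prod_mem_bigrading T e g fun i _ => hg i
  have hGQ : G ∉ pointIdeal Q := by
    rw [Ideal.IsPrime.prod_mem_iff]
    rintro ⟨Q', hQ', hm⟩
    exact (hgQ Q' (Finset.ne_of_mem_erase hQ')).2 hm
  obtain ⟨n, hn⟩ := pow_mem_saturation X.homogeneous
    (SetLike.GradedMul.mul_mem (A := bigrading k) hG hf) (fun Q' hQ' => by
      by_cases hQ : Q' = Q
      · exact Ideal.mul_mem_left _ _ (hQ ▸ hfQ)
      · refine Ideal.mul_mem_right _ _ (Ideal.mem_of_dvd _ (Finset.dvd_prod_of_mem g (a := Q') ?_)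
          (hgQ Q' hQ).1)
        simp [T, hQ, hQ'])
  refine hfP ((pointIdeal_isPrime P).mem_of_pow_mem n (hle ?_))
  refine ⟨_, G ^ n, SetLike.pow_mem_graded n hG,
    fun h' => hGQ ((pointIdeal_isPrime Q).mem_of_pow_mem n h'), ?_⟩
  rw [← mul_pow]
  exact X.saturated hn

theorem eraseIdeal_not_le [IsAlgClosed k] (X : ZeroDimScheme k) (P : Point k) :
    ¬ eraseIdeal X.ideal P ≤ pointIdeal P := by
  classical
  intro h
  set T := X.finite_support.toFinset.erase P
  have h1 : T.inf (component X.ideal) ≤ pointIdeal P := by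
    refine le_trans (fun f hf => mem_eraseIdeal.2 fun Q hQ hQP => ?_) h
    exact (Finset.inf_le (f := component X.ideal) (by simp [T, hQ, hQP]) : _) hf
  obtain ⟨Q, hQ, hle⟩ := (Ideal.IsPrime.inf_le' (pointIdeal_isPrime P)).1 h1
  exact component_not_le X (Finset.ne_of_mem_erase hQ) hle

theorem exists_form_of_degree_notMem (P : Point k) (d : ℕ × ℕ) :
    ∃ s ∈ bigrading k d, s ∉ pointIdeal P := by
  obtain ⟨i, j, hij⟩ := exists_mul_notMem P
  have hi : (X (Sum.inl i) : S k) ∉ pointIdeal P := fun h => hij (Ideal.mul_mem_right _ _ h)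
  have hj : (X (Sum.inr j) : S k) ∉ pointIdeal P := fun h => hij (Ideal.mul_mem_left _ _ h)
  refine ⟨X (Sum.inl i) ^ d.1 * X (Sum.inr j) ^ d.2, ?_, fun h => ?_⟩
  · simpa using mul_mem_bigrading (pow_mem_bigrading (X_inl_mem (k := k) i) d.1)
      (pow_mem_bigrading (X_inr_mem j) d.2)
  · exact ((pointIdeal_isPrime P).mem_or_mem h).elim
      (fun h => hi ((pointIdeal_isPrime P).mem_of_pow_mem _ h))
      (fun h => hj ((pointIdeal_isPrime P).mem_of_pow_mem _ h))

/-! ### Multiplicity one: the point imposes a single linear condition. -/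

theorem stalkIdeal_isMaximal {I : Ideal (S k)} {P : Point k} (h : multiplicity I P = 1) :
    (stalkIdeal I P).IsMaximal := by
  rw [multiplicity, Module.length_eq_one_iff, isSimpleModule_self_iff_isUnit] at h
  refine Ideal.Quotient.maximal_of_isField _ ⟨?_, fun a b => mul_comm a b, fun {a} ha => ?_⟩
  · exact h.1.exists_pair_ne
  · exact (h.2 a ha).exists_right_inv

theorem mem_component_of_multiplicity_one {X : ZeroDimScheme k} {P : Point k}
    (h : multiplicity X.ideal P = 1) {d : ℕ × ℕ} {f : S k} (hf : f ∈ bigrading k d)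
    (hfP : f ∈ pointIdeal P) : f ∈ component X.ideal P := by
  obtain ⟨s, hs, hsP⟩ := exists_form_of_degree_notMem P d
  let c : HomogeneousLocalization.NumDenSameDeg (bigrading k) (pointIdeal P).primeCompl :=
    ⟨d, ⟨f, hf⟩, ⟨s, hs⟩, hsP⟩
  have hval : (HomogeneousLocalization.mk c).val =
      Localization.mk f ⟨s, hsP⟩ := HomogeneousLocalization.val_mk c
  have hm : HomogeneousLocalization.mk c ∈ stalkIdeal X.ideal P := by
    have := stalkIdeal_isMaximal h
    rw [IsLocalRing.eq_maximalIdeal this, IsLocalRing.mem_maximalIdeal, mem_nonunits_iff,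
      ← HomogeneousLocalization.isUnit_iff_isUnit_val, hval, Localization.mk_eq_mk',
      IsLocalization.AtPrime.isUnit_mk'_iff (Localization.AtPrime (pointIdeal P)) (pointIdeal P)]
    exact fun h => h hfP
  have hm' : Localization.mk f ⟨s, hsP⟩ ∈
      X.ideal.map (algebraMap (S k) (Localization.AtPrime (pointIdeal P))) := by
    rw [← hval]; exact hm
  rw [Localization.mk_eq_mk', IsLocalization.mk'_mem_map_algebraMap_iff] at hm'
  obtain ⟨t, ht, htf⟩ := hm'
  -- The denominator `t` need not be a form; one of its bihomogeneous components avoids `I_P` and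
  -- serves instead.
  have hd : ∃ e, (DirectSum.decompose (bigrading k) t e : S k) ∉ pointIdeal P := by
    by_contra! hc
    obtain ⟨T, hT⟩ := sum_decompose t
    exact ht (hT ▸ Ideal.sum_mem _ fun e _ => hc e)
  obtain ⟨e, he⟩ := hd
  refine ⟨e, _, decompose_mem t e, he, ?_⟩
  have h2 := X.homogeneous (e + d) htf
  rwa [DirectSum.coe_decompose_mul_add_of_right_mem (bigrading k) hf] at h2

theorem mem_ideal_iff_of_multiplicity_one [IsAlgClosed k] {X : ZeroDimScheme k} {P : Point k}
    (hPX : P ∈ support X.ideal) (h : multiplicity X.ideal P = 1) {d : ℕ × ℕ} {f : S k}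
    (hf : f ∈ bigrading k d) :
    f ∈ X.ideal ↔ f ∈ eraseIdeal X.ideal P ∧ f ∈ pointIdeal P := by
  refine ⟨fun hfX => ⟨le_eraseIdeal _ _ hfX, hPX hfX⟩, fun ⟨h1, h2⟩ => ?_⟩
  refine mem_of_forall_component X hf fun Q hQ => ?_
  by_cases hQP : Q = P
  · rw [hQP]; exact mem_component_of_multiplicity_one h hf h2
  · exact mem_eraseIdeal.1 h1 Q hQ hQP

end

/-! ### The filtration of `k[s, t]` by bidegree and its Hilbert function. -/

section

open Polynomial

variable {k : Type*} [Field k]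

/-- The polynomials `f(s, t)` of degree less than `i` in `s` and less than `j` in `t`, where
`s` and `t` are the inner and the outer variable of `k[X][X]`. -/
def box (k : Type*) [Field k] (i j : ℕ) : Submodule k k[X][X] where
  carrier := {f | ∀ a b, (f.coeff b).coeff a ≠ 0 → a < i ∧ b < j}
  zero_mem' := by simp
  add_mem' := by
    intro f g hf hg a b h
    by_cases h1 : (f.coeff b).coeff a = 0
    · exact hg a b (by simpa [h1] using h)
    · exact hf a b h1
  smul_mem' := by
    intro c f hf a b h
    exact hf a b fun h0 => h (by simp [h0])

theorem mem_box {i j : ℕ} {f : k[X][X]} :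
    f ∈ box k i j ↔ ∀ a b, (f.coeff b).coeff a ≠ 0 → a < i ∧ b < j := Iff.rfl

theorem box_mono {i j i' j' : ℕ} (hi : i ≤ i') (hj : j ≤ j') : box k i j ≤ box k i' j' :=
  fun _ hf a b h => ⟨(hf a b h).1.trans_le hi, (hf a b h).2.trans_le hj⟩

theorem coeff_coeff_swap (f : k[X][X]) (a b : ℕ) :
    ((Bivariate.swap (R := k) f).coeff a).coeff b = (f.coeff b).coeff a := by
  induction f using Polynomial.induction_on' with
  | add f g hf hg => simp [hf, hg]
  | monomial n p =>
    induction p using Polynomial.induction_on' with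
    | add f g hf hg => simp only [map_add, coeff_add, hf, hg]
    | monomial m c =>
      rw [Bivariate.swap_monomial_monomial]
      simp only [coeff_monomial]
      split_ifs <;> simp_all [coeff_monomial]

theorem swap_mem_box {i j : ℕ} {f : k[X][X]} :
    Bivariate.swap (R := k) f ∈ box k j i ↔ f ∈ box k i j := by
  simp only [mem_box, coeff_coeff_swap]
  exact ⟨fun h a b hab => (h b a hab).symm, fun h a b hab => (h b a hab).symm⟩

theorem exists_mem_box (f : k[X][X]) : ∃ n, f ∈ box k n n := by
  refine ⟨f.natDegree + 1 + (f.support.sup fun b => (f.coeff b).natDegree) + 1, fun a b h => ?_⟩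
  have hb : f.coeff b ≠ 0 := fun h0 => h (by simp [h0])
  have h1 : a ≤ (f.coeff b).natDegree := le_natDegree_of_ne_zero h
  have h2 : (f.coeff b).natDegree ≤ f.support.sup fun b => (f.coeff b).natDegree :=
    Finset.le_sup (f := fun b => (f.coeff b).natDegree) (mem_support_iff.2 hb)
  have h3 : b ≤ f.natDegree := le_natDegree_of_ne_zero hb
  omega

/-- The coefficients of the elements of `box k i j`. -/
def boxCoeff (k : Type*) [Field k] (i j : ℕ) : box k i j →ₗ[k] (Fin i × Fin j → k) where
  toFun f ab := (f.1.coeff ab.2).coeff ab.1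
  map_add' f g := by ext; simp
  map_smul' c f := by ext; simp

theorem boxCoeff_bijective (i j : ℕ) : Function.Bijective (boxCoeff k i j) := by
  constructor
  · rw [injective_iff_map_eq_zero]
    intro f hf
    ext b a
    by_contra h
    obtain ⟨ha, hb⟩ := f.2 a b (by simpa using h)
    exact h (congrFun hf (⟨a, ha⟩, ⟨b, hb⟩))
  · intro c
    have hcoeff : ∀ a b, (((∑ ab : Fin i × Fin j,
        monomial (ab.2 : ℕ) (monomial (ab.1 : ℕ) (c ab)) : k[X][X])).coeff b).coeff a =
        ∑ ab : Fin i × Fin j, if (ab.2 : ℕ) = b ∧ (ab.1 : ℕ) = a then c ab else 0 := by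
      intro a b
      simp only [finsetSum_coeff, coeff_monomial]
      refine Finset.sum_congr rfl fun ab _ => ?_
      by_cases h : (ab.2 : ℕ) = b <;> simp [h, coeff_monomial]
    refine ⟨⟨∑ ab : Fin i × Fin j, monomial (ab.2 : ℕ) (monomial (ab.1 : ℕ) (c ab)),
      fun a b h => ?_⟩, ?_⟩
    · rw [hcoeff] at h
      obtain ⟨ab, _, hab⟩ := Finset.exists_ne_zero_of_sum_ne_zero h
      have : (ab.2 : ℕ) = b ∧ (ab.1 : ℕ) = a := by
        by_contra h'
        simp [h'] at hab
      exact ⟨this.2 ▸ ab.1.2, this.1 ▸ ab.2.2⟩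
    · ext ⟨a, b⟩
      refine (hcoeff a b).trans ?_
      rw [Finset.sum_eq_single (a, b)]
      · simp
      · rintro ⟨a', b'⟩ _ h
        rw [if_neg]
        rintro ⟨h1, h2⟩
        exact h (Prod.ext (Fin.ext h2) (Fin.ext h1))
      · simp

instance (i j : ℕ) : FiniteDimensional k (box k i j) :=
  Module.Finite.equiv (LinearEquiv.ofBijective _ (boxCoeff_bijective i j)).symm

theorem finrank_box (i j : ℕ) : Module.finrank k (box k i j) = i * j := by
  rw [(LinearEquiv.ofBijective _ (boxCoeff_bijective (k := k) i j)).finrank_eq]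
  simp

/-- The Hilbert function of an ideal of `k[s, t]` for the filtration by the spaces `box k i j`. -/
def boxHilbert (K : Ideal k[X][X]) (i j : ℕ) : ℤ :=
  Module.finrank k ((box k i j).map (Ideal.Quotient.mkₐ k K).toLinearMap)

/-- The elements of `K` in `box k i j`. -/
def idealBox (K : Ideal k[X][X]) (i j : ℕ) : Submodule k k[X][X] :=
  K.restrictScalars k ⊓ box k i j

theorem mem_idealBox {K : Ideal k[X][X]} {i j : ℕ} {f : k[X][X]} :
    f ∈ idealBox K i j ↔ f ∈ K ∧ f ∈ box k i j := Iff.rfl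

instance (K : Ideal k[X][X]) (i j : ℕ) : FiniteDimensional k (idealBox K i j) :=
  Submodule.finiteDimensional_of_le (S₂ := box k i j) inf_le_right

theorem finrank_map_add_finrank_inf {V W : Type*} [AddCommGroup V] [Module k V] [AddCommGroup W]
    [Module k W] (f : V →ₗ[k] W) (p : Submodule k V) [FiniteDimensional k p] :
    Module.finrank k (p.map f) + Module.finrank k (LinearMap.ker f ⊓ p : Submodule k V) =
      Module.finrank k p := by
  rw [← LinearMap.finrank_range_add_finrank_ker (f.domRestrict p), LinearMap.range_domRestrict,
    LinearMap.ker_domRestrict, inf_comm, ← Submodule.map_comap_subtype]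
  congr 1
  exact LinearEquiv.finrank_eq
    (Submodule.equivMapOfInjective p.subtype p.injective_subtype _).symm

theorem boxHilbert_eq (K : Ideal k[X][X]) (i j : ℕ) :
    boxHilbert K i j = i * j - Module.finrank k (idealBox K i j) := by
  have h := finrank_map_add_finrank_inf (Ideal.Quotient.mkₐ k K).toLinearMap (box k i j)
  have e : LinearMap.ker (Ideal.Quotient.mkₐ k K).toLinearMap ⊓ box k i j = idealBox K i j := by
    ext f
    simp [mem_idealBox, Ideal.Quotient.eq_zero_iff_mem]
  rw [e, finrank_box] at h
  rw [boxHilbert]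
  zify at h
  linarith

/-- The polynomial in `t` that multiplies `s ^ i`. -/
def innerCoeff (k : Type*) [Field k] (i : ℕ) : k[X][X] →ₗ[k] k[X] where
  toFun f := (Bivariate.swap (R := k) f).coeff i
  map_add' f g := by simp
  map_smul' c f := by simp

theorem coeff_innerCoeff (i b : ℕ) (f : k[X][X]) :
    (innerCoeff k i f).coeff b = (f.coeff b).coeff i := coeff_coeff_swap f i b

/-- Rank-nullity for the coefficient of the top power `s ^ i`: its kernel consists of the elements
of lower degree in `s`. -/
theorem finrank_idealBox_succ (K : Ideal k[X][X]) (i j : ℕ) :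
    Module.finrank k ((idealBox K (i + 1) j).map (innerCoeff k i)) +
      Module.finrank k (idealBox K i j) = Module.finrank k (idealBox K (i + 1) j) := by
  rw [← finrank_map_add_finrank_inf (innerCoeff k i) (idealBox K (i + 1) j)]
  suffices e : idealBox K i j = LinearMap.ker (innerCoeff k i) ⊓ idealBox K (i + 1) j by rw [← e]
  ext f
  simp only [Submodule.mem_inf, mem_idealBox, LinearMap.mem_ker]
  constructor
  · rintro ⟨h1, h2⟩
    refine ⟨?_, h1, box_mono (Nat.le_succ i) le_rfl h2⟩
    ext b
    rw [coeff_innerCoeff, coeff_zero]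
    by_contra h
    exact lt_irrefl _ (h2 _ _ h).1
  · rintro ⟨h0, h1, h2⟩
    refine ⟨h1, fun a b h => ⟨?_, (h2 a b h).2⟩⟩
    refine lt_of_le_of_ne (Nat.lt_succ_iff.1 (h2 a b h).1) fun hai => h ?_
    rw [hai, ← coeff_innerCoeff, h0, coeff_zero]

theorem exists_innerCoeff_ne_zero {K : Ideal k[X][X]} {i j : ℕ} (h : idealBox K (i + 1) j ≠ ⊥) :
    ∃ f ∈ idealBox K (i + 1) j, innerCoeff k i f ≠ 0 := by
  classical
  obtain ⟨f, hf, hf0⟩ := Submodule.exists_mem_ne_zero_of_ne_bot h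
  obtain ⟨b, a, hab⟩ : ∃ b a, (f.coeff b).coeff a ≠ 0 := by
    by_contra! hc
    exact hf0 (by ext b a; simpa using hc b a)
  set T : Finset ℕ := (Finset.range (i + 1)).filter fun a => ∃ b, (f.coeff b).coeff a ≠ 0
  have hT : T.Nonempty := by
    exact ⟨a, Finset.mem_filter.2 ⟨Finset.mem_range.2 (hf.2 a b hab).1, b, hab⟩⟩
  set m := T.max' hT
  obtain ⟨hm, b', hb'⟩ := Finset.mem_filter.1 (T.max'_mem hT)
  have hm1 : m < i + 1 := Finset.mem_range.1 hm
  have hmax : ∀ a b, (f.coeff b).coeff a ≠ 0 → a ≤ m := fun a b hab =>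
    T.le_max' a (Finset.mem_filter.2 ⟨Finset.mem_range.2 (hf.2 a b hab).1, b, hab⟩)
  have hc : ∀ a b, ((C (X ^ (i - m)) * f).coeff b).coeff a =
      if i - m ≤ a then (f.coeff b).coeff (a - (i - m)) else 0 := by
    intro a b
    rw [coeff_C_mul, coeff_X_pow_mul']
  -- With `m` the exact `s`-degree of `f`, multiplication by `s ^ (i - m)` raises it to `i` and
  -- stays in the ideal.
  refine ⟨C (X ^ (i - m)) * f, ⟨K.mul_mem_left _ hf.1, fun a b h => ?_⟩, fun h => ?_⟩
  · rw [hc] at h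
    split_ifs at h with h1
    · have := hmax _ _ h
      exact ⟨by omega, (hf.2 _ _ h).2⟩
    · exact absurd rfl h
  · have h1 : (innerCoeff k i (C (X ^ (i - m)) * f)).coeff b' = 0 := by rw [h, coeff_zero]
    rw [coeff_innerCoeff, hc, if_pos (Nat.sub_le i m),
      Nat.sub_sub_self (Nat.lt_succ_iff.1 hm1)] at h1
    exact hb' h1

theorem eq_bot_of_X_mul_mem {V : Submodule k k[X]} {j : ℕ}
    (hj : ∀ v ∈ V, ∀ b, v.coeff b ≠ 0 → b < j) (hX : ∀ v ∈ V, X * v ∈ V) : V = ⊥ := by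
  rw [Submodule.eq_bot_iff]
  intro v hv
  by_contra h
  have hn : ∀ n, X ^ n * v ∈ V := by
    intro n
    induction n with
    | zero => simpa using hv
    | succ n ih => rw [pow_succ', mul_assoc]; exact hX _ ih
  have h1 := hj _ (hn j) (v.natDegree + j) (by rw [coeff_X_pow_mul]; simpa using h)
  omega

/-- The first difference of the Hilbert function is at most zero in the degrees of the nonzero
elements of the ideal. -/
theorem boxHilbert_diff_le_zero {K : Ideal k[X][X]} {i j : ℕ}
    (h : idealBox K (i + 1) (j + 1) ≠ ⊥) :
    boxHilbert K (i + 1) (j + 1) - boxHilbert K i (j + 1) - boxHilbert K (i + 1) j +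
      boxHilbert K i j ≤ 0 := by
  set V := (idealBox K (i + 1) (j + 1)).map (innerCoeff k i)
  set V' := (idealBox K (i + 1) j).map (innerCoeff k i)
  have h1 := finrank_idealBox_succ K i (j + 1)
  have h2 := finrank_idealBox_succ K i j
  have hle : V' ≤ V := Submodule.map_mono fun f hf => ⟨hf.1, box_mono le_rfl (Nat.le_succ j) hf.2⟩
  -- Multiplication by `t` maps `V'` into `V`. If they were equal, `V'` would be stable under `t`
  -- with bounded degrees, hence zero, although `V` is not.
  have hne : V' ≠ V := by
    intro heq
    obtain ⟨f, hf, hf0⟩ := exists_innerCoeff_ne_zero h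
    have hV : V' = ⊥ := by
      refine eq_bot_of_X_mul_mem (j := j) ?_ ?_
      · rintro _ ⟨g, hg, rfl⟩ b hb
        rw [coeff_innerCoeff] at hb
        exact (hg.2 _ _ hb).2
      · rintro _ ⟨g, hg, rfl⟩
        rw [heq]
        refine ⟨X * g, ⟨K.mul_mem_left _ hg.1, fun a b hab => ?_⟩, ?_⟩
        · cases b with
          | zero => simp at hab
          | succ b =>
            rw [coeff_X_mul] at hab
            exact ⟨(hg.2 _ _ hab).1, Nat.succ_lt_succ (hg.2 _ _ hab).2⟩
        · ext b
          cases b with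
          | zero => rw [coeff_innerCoeff]; simp
          | succ b => simp [coeff_innerCoeff, coeff_X_mul]
    have : innerCoeff k i f ∈ V' := heq ▸ ⟨f, hf, rfl⟩
    rw [hV] at this
    exact hf0 this
  have hlt := Submodule.finrank_lt_finrank_of_lt (lt_of_le_of_ne hle hne)
  -- The boxes contribute a mixed difference of 1, so the total is `1 - (dim V - dim V')`.
  simp only [boxHilbert_eq]
  push_cast
  have h1' : (Module.finrank k V : ℤ) + Module.finrank k (idealBox K i (j + 1)) =
    Module.finrank k (idealBox K (i + 1) (j + 1)) := by exact_mod_cast h1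
  have h2' : (Module.finrank k V' : ℤ) + Module.finrank k (idealBox K i j) =
    Module.finrank k (idealBox K (i + 1) j) := by exact_mod_cast h2
  have h3 : (Module.finrank k V' : ℤ) + 1 ≤ Module.finrank k V := by exact_mod_cast hlt
  linarith

/-! ### Separators at the origin and their staircase. -/

/-- The value at the origin. -/
def originEval (k : Type*) [Field k] : k[X][X] →ₐ[k] k :=
  (aeval (0 : k)).comp (mapAlgHom (aeval (0 : k)))

theorem originEval_apply (f : k[X][X]) : originEval k f = (f.coeff 0).coeff 0 := by
  simp [originEval, coe_aeval_eq_eval, ← coeff_zero_eq_eval_zero]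

theorem originEval_swap (f : k[X][X]) :
    originEval k (Bivariate.swap (R := k) f) = originEval k f := by
  rw [originEval_apply, originEval_apply, coeff_coeff_swap]

/-- `K` contains a polynomial in `box k i j` that does not vanish at the origin. -/
def HasSep (K : Ideal k[X][X]) (i j : ℕ) : Prop :=
  ∃ f ∈ K, f ∈ box k i j ∧ originEval k f ≠ 0

theorem HasSep.mono {K : Ideal k[X][X]} {i j i' j' : ℕ} (h : HasSep K i j) (hi : i ≤ i')
    (hj : j ≤ j') : HasSep K i' j' := by
  obtain ⟨f, hf, hfb, h0⟩ := h
  exact ⟨f, hf, box_mono hi hj hfb, h0⟩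

open Classical in
-- Evaluation at the origin maps `idealBox K i j` onto `k` or to zero, according to whether a
-- separator exists; its kernel is `idealBox K' i j`.
theorem boxHilbert_inf_origin {K K' : Ideal k[X][X]}
    (h : ∀ f, f ∈ K' ↔ f ∈ K ∧ originEval k f = 0) (i j : ℕ) :
    boxHilbert K' i j = boxHilbert K i j + if HasSep K i j then 1 else 0 := by
  have h1 := finrank_map_add_finrank_inf (originEval k).toLinearMap (idealBox K i j)
  have e : LinearMap.ker (originEval k).toLinearMap ⊓ idealBox K i j = idealBox K' i j := by
    ext f
    simp only [Submodule.mem_inf, LinearMap.mem_ker, mem_idealBox, h, AlgHom.toLinearMap_apply]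
    tauto
  rw [e] at h1
  rw [boxHilbert_eq, boxHilbert_eq, ← h1]
  have h2 : Module.finrank k ((idealBox K i j).map (originEval k).toLinearMap) =
      if HasSep K i j then 1 else 0 := by
    split_ifs with hs
    · obtain ⟨f, hf, hfb, h0⟩ := hs
      have : (idealBox K i j).map (originEval k).toLinearMap = ⊤ := by
        rw [Submodule.eq_top_iff']
        intro c
        refine ⟨(c / originEval k f) • f, Submodule.smul_mem _ _ ⟨hf, hfb⟩, ?_⟩
        simp [h0]
      rw [this]
      simp
    · have : (idealBox K i j).map (originEval k).toLinearMap = ⊥ := by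
        rw [Submodule.eq_bot_iff]
        rintro _ ⟨f, hf, rfl⟩
        by_contra h0
        exact hs ⟨f, hf.1, hf.2, h0⟩
      rw [this]
      simp
  rw [h2]
  push_cast
  ring

/-- The corner argument: if separators exist far out in both directions, and the second difference
vanishes beyond `(q, p)`, then there is a separator of bidegree `(q, p)`. -/
theorem hasSep_of_diff_eq_zero {K K' : Ideal k[X][X]}
    (h : ∀ f, f ∈ K' ↔ f ∈ K ∧ originEval k f = 0) {q p i₀ j₀ : ℕ}
    (hj : HasSep K (q + 1) j₀) (hi : HasSep K i₀ (p + 1))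
    (hd : ∀ i j, q + 1 ≤ i → p + 1 ≤ j → boxHilbert K' (i + 1) (j + 1) - boxHilbert K' i (j + 1) -
      boxHilbert K' (i + 1) j + boxHilbert K' i j = 0) : HasSep K (q + 1) (p + 1) := by
  classical
  by_contra hn
  -- An inner corner: `j₁ + 1` is the least height of a separator of width `q + 1`, and `i₁ + 1` is
  -- the least width at height `j₁`. Box sizes exceed degrees by one.
  have hex : ∃ j, HasSep K (q + 1) j := ⟨j₀, hj⟩
  obtain ⟨j₁, hj₁⟩ : ∃ j₁, Nat.find hex = j₁ + 1 := by
    refine Nat.exists_eq_succ_of_ne_zero fun h0 => hn ((Nat.find_spec hex).mono le_rfl ?_)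
    omega
  have hs1 : HasSep K (q + 1) (j₁ + 1) := hj₁ ▸ Nat.find_spec hex
  have hs2 : ¬ HasSep K (q + 1) j₁ := Nat.find_min hex (by omega)
  have hpj : p + 1 ≤ j₁ := by
    by_contra hlt
    exact hn (hs1.mono le_rfl (by omega))
  have hex' : ∃ i, HasSep K i j₁ := ⟨i₀, hi.mono le_rfl hpj⟩
  obtain ⟨i₁, hi₁⟩ : ∃ i₁, Nat.find hex' = i₁ + 1 := by
    refine Nat.exists_eq_succ_of_ne_zero fun h0 => hs2 ((Nat.find_spec hex').mono ?_ le_rfl)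
    omega
  have hs3 : HasSep K (i₁ + 1) j₁ := hi₁ ▸ Nat.find_spec hex'
  have hs4 : ¬ HasSep K i₁ j₁ := Nat.find_min hex' (by omega)
  have hqi : q + 1 ≤ i₁ := by
    by_contra hlt
    exact hs2 (hs3.mono (by omega) le_rfl)
  have hs5 : HasSep K i₁ (j₁ + 1) := hs1.mono hqi le_rfl
  have hs6 : HasSep K (i₁ + 1) (j₁ + 1) := hs3.mono le_rfl (Nat.le_succ _)
  have h1 := hd i₁ j₁ hqi hpj
  -- At the corner the indicator of separators contributes `1 - 1 - 1 + 0 = -1`.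
  simp only [boxHilbert_inf_origin h, hs3, hs4, hs5, hs6, if_true, if_false] at h1
  obtain ⟨f, hf, hfb, h0⟩ := hs6
  have h2 := boxHilbert_diff_le_zero (K := K) (i := i₁) (j := j₁) fun hbot => h0 (by
    have : f ∈ idealBox K (i₁ + 1) (j₁ + 1) := ⟨hf, hfb⟩
    rw [hbot, Submodule.mem_bot] at this
    rw [this, map_zero])
  linarith

/-- Division by a polynomial in `t` alone. -/
theorem exists_sub_mem_box {γ : k[X]} (hγ : γ ≠ 0) {d i : ℕ} (hd : γ.natDegree ≤ d) (j : ℕ) :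
    ∀ f ∈ box k i j, ∃ g ∈ box k i d, γ.map C ∣ f - g := by
  induction j with
  | zero => exact fun f hf => ⟨f, box_mono le_rfl (Nat.zero_le d) hf, by simp⟩
  | succ j ih =>
    intro f hf
    rcases Nat.lt_or_ge j d with hjd | hjd
    · exact ⟨f, box_mono le_rfl hjd hf, by simp⟩
    set n := γ.natDegree
    have hl : γ.leadingCoeff ≠ 0 := leadingCoeff_ne_zero.2 hγ
    -- The leading coefficient of `γ` is a constant, so cancelling the top power of `t` does not
    -- raise the degree in `s`.
    set c : k[X] := f.coeff j * C γ.leadingCoeff⁻¹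
    have hc : ∀ b, (f - C c * (X ^ (j - n) * γ.map C)).coeff b =
        f.coeff b - c * (if j - n ≤ b then C (γ.coeff (b - (j - n))) else 0) := by
      intro b
      rw [coeff_sub, coeff_C_mul, coeff_X_pow_mul']
      simp [coeff_map]
    obtain ⟨g, hg, hdvd⟩ := ih (f - C c * (X ^ (j - n) * γ.map C)) (by
      intro a b hab
      rw [hc] at hab
      constructor
      · by_contra ha
        apply hab
        have h1 : ∀ b, (f.coeff b).coeff a = 0 := fun b => by
          by_contra h; exact ha (hf a b h).1
        split_ifs <;> simp [c, h1]
      · by_contra hb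
        apply hab
        rcases Nat.lt_or_ge j b with hjb | hjb
        · have h1 : (f.coeff b).coeff a = 0 := by
            by_contra h; have := (hf a b h).2; omega
          have h2 : γ.coeff (b - (j - n)) = 0 := coeff_eq_zero_of_natDegree_lt (by omega)
          rw [if_pos (by omega), h2]
          simp [h1]
        · obtain rfl : b = j := by omega
          rw [if_pos (by omega), Nat.sub_sub_self (by omega)]
          simp [c, n, hl])
    refine ⟨g, hg, ?_⟩
    have e : f - g = f - C c * (X ^ (j - n) * γ.map C) - g + C c * X ^ (j - n) * γ.map C := by ring
    rw [e]
    exact dvd_add hdvd (dvd_mul_left _ _)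

theorem HasSep.of_dvd {K : Ideal k[X][X]} {γ : k[X]} (hγ : γ ≠ 0) (hK : γ.map C ∈ K)
    (h0 : originEval k (γ.map C) = 0) {i j d : ℕ} (hd : γ.natDegree ≤ d) (h : HasSep K i j) :
    HasSep K i d := by
  obtain ⟨f, hf, hfb, hf0⟩ := h
  obtain ⟨g, hg, r, hr⟩ := exists_sub_mem_box hγ hd j f hfb
  have e : g = f - γ.map C * r := by rw [← hr]; ring
  refine ⟨g, e ▸ K.sub_mem hf (K.mul_mem_right _ hK), hg, ?_⟩
  rw [e, map_sub, map_mul, h0, zero_mul, sub_zero]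
  exact hf0

/-! ### Restriction to the line `s = 0`. -/

/-- Restriction of `f(s, t)` to the line `s = 0`. -/
def innerEval (k : Type*) [Field k] : k[X][X] →ₐ[k] k[X] := mapAlgHom (aeval (0 : k))

theorem coeff_innerEval (f : k[X][X]) (b : ℕ) :
    (innerEval k f).coeff b = (f.coeff b).coeff 0 := by
  simp [innerEval, ← coeff_zero_eq_eval_zero]

theorem innerEval_map_C (v : k[X]) : innerEval k (v.map C) = v := by
  ext b
  simp [coeff_innerEval]

theorem innerEval_surjective : Function.Surjective (innerEval k) := fun v =>
  ⟨v.map C, innerEval_map_C v⟩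

theorem innerEval_eq_zero_iff {f : k[X][X]} : innerEval k f = 0 ↔ C X ∣ f := by
  rw [C_dvd_iff_dvd_coeff, Polynomial.ext_iff]
  simp only [coeff_innerEval, coeff_zero, X_dvd_iff]

theorem innerEval_C (δ : k[X]) : innerEval k (C δ) = C (δ.coeff 0) := by
  ext b
  rw [coeff_innerEval, coeff_C, coeff_C]
  split_ifs <;> simp

theorem sup_span_C_X (K : Ideal k[X][X]) :
    K ⊔ Ideal.span {C X} = (K.map (innerEval k)).comap (innerEval k) := by
  rw [Ideal.comap_map_of_surjective _ innerEval_surjective]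
  congr 1
  ext f
  rw [Ideal.mem_span_singleton, Ideal.mem_comap, Ideal.mem_bot, innerEval_eq_zero_iff]

/-- The points of the scheme defined by `K` on the line `s = 0`. -/
def lineQuotientEquiv (K : Ideal k[X][X]) :
    (k[X][X] ⧸ (K ⊔ Ideal.span {C X})) ≃ₐ[k] (k[X] ⧸ K.map (innerEval k)) :=
  (Ideal.quotientEquivAlgOfEq k (by
    rw [sup_span_C_X]
    ext f
    simp [RingHom.mem_ker, Ideal.Quotient.eq_zero_iff_mem])).trans
  (Ideal.quotientKerAlgEquivOfSurjective
    (f := (Ideal.Quotient.mkₐ k (K.map (innerEval k))).comp (innerEval k))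
    ((Ideal.Quotient.mkₐ_surjective k _).comp innerEval_surjective))

/-- The restriction of `K` to the line is principal in `k[t]`; its generator `w` counts the points
on the line, and `w(0) ≠ 0` because `f₀` restricts to a multiple of `w`. -/
theorem exists_generator (K : Ideal k[X][X]) {f₀ : k[X][X]} (hf₀ : f₀ ∈ K)
    (h0 : originEval k f₀ ≠ 0) : ∃ w : k[X], w.coeff 0 ≠ 0 ∧
      Module.Finite k (k[X][X] ⧸ (K ⊔ Ideal.span {C X})) ∧
      Module.finrank k (k[X][X] ⧸ (K ⊔ Ideal.span {C X})) = w.natDegree ∧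
      (∀ f ∈ K, w ∣ innerEval k f) ∧ ∀ v, w ∣ v → ∃ f ∈ K, innerEval k f = v := by
  obtain ⟨w, hw⟩ := IsPrincipalIdealRing.principal (K.map (innerEval k))
  replace hw : K.map (innerEval k) = Ideal.span {w} := hw
  have hdvd : ∀ f ∈ K, w ∣ innerEval k f := fun f hf => by
    rw [← Ideal.mem_span_singleton, ← hw]
    exact Ideal.mem_map_of_mem _ hf
  have hw0 : w.coeff 0 ≠ 0 := by
    intro h
    obtain ⟨r, hr⟩ := hdvd f₀ hf₀
    apply h0
    rw [originEval_apply, ← coeff_innerEval, hr, mul_coeff_zero, h, zero_mul]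
  have hwne : w ≠ 0 := fun h => hw0 (by simp [h])
  have hfin : Module.Finite k (k[X] ⧸ Ideal.span {w}) :=
    (AdjoinRoot.powerBasis hwne).finite
  refine ⟨w, hw0, ?_, ?_, hdvd, fun v hv => ?_⟩
  · rw [← hw] at hfin
    exact Module.Finite.equiv (lineQuotientEquiv K).symm.toLinearEquiv
  · rw [(lineQuotientEquiv K).toLinearEquiv.finrank_eq, hw]
    exact finrank_quotient_span_eq_natDegree
  · rw [← Ideal.mem_span_singleton, ← hw,
      Ideal.mem_map_iff_of_surjective _ innerEval_surjective] at hv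
    exact hv

/-- Successive approximation in powers of `s`: restrict the error term to `s = 0`, divide by `w`,
and lift the multiple of `w` to `K`. What remains of it is divisible by `s`. -/
theorem exists_approx {K : Ideal k[X][X]} {w : k[X]} (hw : w ≠ 0)
    (h : ∀ v, w ∣ v → ∃ f ∈ K, innerEval k f = v) (n : ℕ) (f : k[X][X]) :
    ∃ r g : k[X][X], r.degree < w.natDegree ∧ f - r - C (X ^ n) * g ∈ K := by
  induction n with
  | zero => exact ⟨0, f, by simp [bot_lt_iff_ne_bot], by simp⟩
  | succ n ih =>
    obtain ⟨r, g, hr, hK⟩ := ih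
    obtain ⟨f₁, hf₁, he⟩ := h (w * (innerEval k g / w)) (dvd_mul_right _ _)
    set r₁ := (innerEval k g % w).map C
    have hg : innerEval k (g - f₁ - r₁) = 0 := by
      rw [map_sub, map_sub, he, innerEval_map_C, sub_sub, EuclideanDomain.div_add_mod, sub_self]
    obtain ⟨g₁, hg₁⟩ := innerEval_eq_zero_iff.1 hg
    have hr₁ : r₁.degree < w.natDegree := by
      refine degree_map_le.trans_lt ?_
      rw [← degree_eq_natDegree hw]
      exact EuclideanDomain.mod_lt _ hw
    refine ⟨r + C (X ^ n) * r₁, g₁, ?_, ?_⟩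
    · refine (degree_add_le _ _).trans_lt (max_lt hr ?_)
      rw [degree_C_mul (pow_ne_zero n X_ne_zero)]
      exact hr₁
    · have e : f - (r + C (X ^ n) * r₁) - C (X ^ (n + 1)) * g₁ =
          f - r - C (X ^ n) * g + C (X ^ n) * f₁ := by
        have : g = f₁ + r₁ + C X * g₁ := by rw [← hg₁]; ring
        rw [this, pow_succ, C_mul]
        ring
      rw [e]
      exact K.add_mem hK (K.mul_mem_left _ hf₁)

/-- If `p` is the number of points of `K` on the line `s = 0`, then separators have degree at least
`p` in `t`, and degree `p` is attained. -/
theorem hasSep_of_line {K : Ideal k[X][X]} {δ : k[X]} (hδ : δ ≠ 0) (hδK : C δ ∈ K)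
    {f₀ : k[X][X]} (hf₀ : f₀ ∈ K) (h0 : originEval k f₀ ≠ 0) {p : ℕ}
    (hp : p = Module.finrank k (k[X][X] ⧸ (K ⊔ Ideal.span {C X}))) :
    (∀ i j, HasSep K i j → p + 1 ≤ j) ∧ ∃ i, HasSep K i (p + 1) := by
  obtain ⟨w, hw0, -, hrank, hdvd, hlift⟩ := exists_generator K hf₀ h0
  have hw : w ≠ 0 := fun h => hw0 (by simp [h])
  rw [hrank] at hp
  subst hp
  constructor
  · rintro i j ⟨f, hf, hfb, hf0⟩
    rw [originEval_apply, ← coeff_innerEval] at hf0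
    have hne : innerEval k f ≠ 0 := fun h => hf0 (by simp [h])
    have h1 := natDegree_le_of_dvd (hdvd f hf) hne
    have h2 : ((f.coeff (innerEval k f).natDegree).coeff 0) ≠ 0 := by
      rw [← coeff_innerEval]
      exact leadingCoeff_ne_zero.2 hne
    have := (hfb _ _ h2).2
    omega
  -- Write `δ = s ^ n * h` with `h(0) ≠ 0`. The error `s ^ n * g` in the approximation of `w`
  -- becomes a multiple of `δ` after multiplication by `h`, so `h * (w - r)` lies in `K` and has
  -- `t`-degree at most `deg w`.
  · obtain ⟨h, hh, hdiv⟩ := exists_eq_pow_rootMultiplicity_mul_and_not_dvd δ hδ 0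
    rw [C_0, sub_zero] at hh hdiv
    rw [X_dvd_iff] at hdiv
    set n := δ.rootMultiplicity 0
    obtain ⟨r, g, hr, hK⟩ := exists_approx hw hlift n (w.map C)
    set κ := C h * (w.map C - r)
    have hκ : κ ∈ K := by
      have e : κ = C h * (w.map C - r - C (X ^ n) * g) + g * C δ := by
        rw [hh, C_mul]; ring
      rw [e]
      exact K.add_mem (K.mul_mem_left _ hK) (K.mul_mem_left _ hδK)
    have hev : innerEval k κ = C (h.coeff 0) * (w - innerEval k r) := by
      rw [map_mul, innerEval_C, map_sub, innerEval_map_C]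
    -- Restricted to the line, `r` is a multiple of `w` of smaller degree. Hence the value of `κ` at
    -- the origin is `h(0) * w(0)`.
    have hr0 : innerEval k r = 0 := by
      have h1 := hdvd κ hκ
      rw [hev, mul_sub, dvd_sub_right (dvd_mul_left _ _)] at h1
      have h2 : w ∣ innerEval k r := by
        have := dvd_mul_of_dvd_right h1 (C (h.coeff 0)⁻¹)
        rwa [← mul_assoc, ← C_mul, inv_mul_cancel₀ hdiv, C_1, one_mul] at this
      refine eq_zero_of_dvd_of_degree_lt h2 ?_
      rw [degree_eq_natDegree hw]
      exact degree_map_le.trans_lt hr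
    obtain ⟨m, hm⟩ := exists_mem_box κ
    refine ⟨m, κ, hκ, fun a b hab => ⟨(hm a b hab).1, ?_⟩, ?_⟩
    · have hb : κ.coeff b ≠ 0 := fun h0 => hab (by simp [h0])
      have h3 : κ.natDegree ≤ w.natDegree := by
        refine (natDegree_C_mul_le _ _).trans ((natDegree_sub_le _ _).trans (max_le ?_ ?_))
        · exact natDegree_map_le
        · exact natDegree_le_of_degree_le hr.le
      exact Nat.lt_succ_iff.2 ((le_natDegree_of_ne_zero hb).trans h3)
    · rw [originEval_apply, ← coeff_innerEval, hev, hr0, sub_zero, coeff_C_mul]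
      exact mul_ne_zero hdiv hw0

/-- The images of the square boxes exhaust the finite-dimensional quotient, so the chain stabilises
at the whole of it. -/
theorem exists_boxHilbert_eq (I : Ideal k[X][X]) [Module.Finite k (k[X][X] ⧸ I)] :
    ∃ n, ∀ i j, n ≤ i → n ≤ j → boxHilbert I i j = Module.finrank k (k[X][X] ⧸ I) := by
  set F : ℕ →o Submodule k (k[X][X] ⧸ I) :=
    ⟨fun n => (box k n n).map (Ideal.Quotient.mkₐ k I).toLinearMap,
      fun m n h => Submodule.map_mono (box_mono h h)⟩
  obtain ⟨n, hn⟩ := monotone_stabilizes_iff_noetherian.2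
    (inferInstance : IsNoetherian k (k[X][X] ⧸ I)) F
  have htop : F n = ⊤ := by
    rw [Submodule.eq_top_iff']
    intro x
    obtain ⟨f, rfl⟩ := Ideal.Quotient.mkₐ_surjective k I x
    obtain ⟨m, hm⟩ := exists_mem_box f
    rw [hn (max m n) (le_max_right _ _)]
    exact ⟨f, box_mono (le_max_left _ _) (le_max_left _ _) hm, rfl⟩
  refine ⟨n, fun i j hi hj => ?_⟩
  have : (box k i j).map (Ideal.Quotient.mkₐ k I).toLinearMap = ⊤ :=
    top_le_iff.1 (htop.ge.trans (Submodule.map_mono (box_mono hi hj)))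
  rw [boxHilbert, this, finrank_top]

theorem mul_mem_box {i j i' j' : ℕ} {f g : k[X][X]} (hf : f ∈ box k (i + 1) (j + 1))
    (hg : g ∈ box k (i' + 1) (j' + 1)) : f * g ∈ box k (i + i' + 1) (j + j' + 1) := by
  intro a b h
  rw [coeff_mul, finsetSum_coeff] at h
  obtain ⟨⟨b₁, b₂⟩, hb, h⟩ := Finset.exists_ne_zero_of_sum_ne_zero h
  rw [coeff_mul] at h
  obtain ⟨⟨a₁, a₂⟩, ha, h⟩ := Finset.exists_ne_zero_of_sum_ne_zero h
  rw [Finset.HasAntidiagonal.mem_antidiagonal] at ha hb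
  have h1 := hf _ _ (left_ne_zero_of_mul h)
  have h2 := hg _ _ (right_ne_zero_of_mul h)
  dsimp only at h1 h2 ha hb
  omega

theorem pow_mem_box {i j : ℕ} {f : k[X][X]} (hf : f ∈ box k (i + 1) (j + 1)) (n : ℕ) :
    f ^ n ∈ box k (n * i + 1) (n * j + 1) := by
  induction n with
  | zero =>
    intro a b h
    rw [pow_zero, coeff_one] at h
    split_ifs at h with hb
    · rw [coeff_one] at h
      split_ifs at h with ha
      · omega
      · exact absurd rfl h
    · simp at h
  | succ n ih =>
    rw [pow_succ, Nat.succ_mul, Nat.succ_mul]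
    exact mul_mem_box ih hf

theorem C_mem_box (p : k[X]) {i : ℕ} (hp : p.natDegree ≤ i) : (C p : k[X][X]) ∈ box k (i + 1) 1 := by
  intro a b h
  rw [coeff_C] at h
  split_ifs at h with hb
  · have := le_natDegree_of_ne_zero h
    omega
  · simp at h

theorem exists_eq_C_of_mem_box {i : ℕ} {f : k[X][X]} (hf : f ∈ box k (i + 1) 1) :
    ∃ δ : k[X], δ.natDegree ≤ i ∧ f = C δ := by
  refine ⟨f.coeff 0, ?_, ?_⟩
  · by_contra h
    have h1 : f.coeff 0 ≠ 0 := fun h0 => by simp [h0] at h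
    have := (hf (f.coeff 0).natDegree 0 (leadingCoeff_ne_zero.2 h1)).1
    omega
  · ext b a
    rw [coeff_C]
    split_ifs with hb
    · rw [hb]
    · rw [coeff_zero]
      by_contra h
      have := (hf a b h).2
      omega

/-! ### Affine charts and dehomogenisation. -/

/-- The affine chart `x = u + s e`, `y = v + t e'` of the cone. -/
def chart (u e v e' : Fin 2 → k) : S k →ₐ[k] k[X][X] :=
  MvPolynomial.aeval (Sum.elim (fun n => C (C (u n) + C (e n) * X))
    (fun n => C (C (v n)) + C (C (e' n)) * X))

variable {u e v e' : Fin 2 → k}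

theorem chart_X_inl (n : Fin 2) :
    chart u e v e' (MvPolynomial.X (Sum.inl n)) = C (C (u n) + C (e n) * X) := by
  simp [chart]

theorem chart_X_inr (n : Fin 2) :
    chart u e v e' (MvPolynomial.X (Sum.inr n)) = C (C (v n)) + C (C (e' n)) * X := by
  simp [chart]

theorem chart_mem_box {i j : ℕ} {f : S k} (hf : f ∈ bigrading k (i, j)) :
    chart u e v e' f ∈ box k (i + 1) (j + 1) := by
  rw [chart, MvPolynomial.aeval_def, MvPolynomial.eval₂_eq']
  refine Submodule.sum_mem _ fun d hd => ?_
  have hw := hf (MvPolynomial.mem_support_iff.1 hd)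
  have h1 : d (Sum.inl 0) + d (Sum.inl 1) = i ∧ d (Sum.inr 0) + d (Sum.inr 1) = j := by
    rw [Finsupp.weight_apply, Finsupp.sum_fintype _ _ (by simp)] at hw
    simpa [Fintype.sum_sum_type, wt, Prod.ext_iff] using hw
  obtain ⟨rfl, rfl⟩ := h1
  rw [← Algebra.smul_def]
  refine Submodule.smul_mem _ _ ?_
  simp only [Fintype.prod_sum_type, Fin.prod_univ_two, Sum.elim_inl, Sum.elim_inr]
  have hx : ∀ n, (C (C (u n) + C (e n) * X) : k[X][X]) ∈ box k (1 + 1) (0 + 1) := fun n =>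
    C_mem_box _ (by rw [add_comm]; exact natDegree_linear_le)
  have hy : ∀ n, (C (C (v n)) + C (C (e' n)) * X : k[X][X]) ∈ box k (0 + 1) (1 + 1) := fun n => by
    rw [← swap_mem_box]
    convert C_mem_box (C (v n) + C (e' n) * X) (i := 1)
      (by rw [add_comm]; exact natDegree_linear_le) using 1
    rw [map_add, map_mul, Bivariate.swap_C_C, Bivariate.swap_C_C, Bivariate.swap_Y]
    simp
  have := mul_mem_box (mul_mem_box (pow_mem_box (hx 0) (d (Sum.inl 0)))
    (pow_mem_box (hx 1) (d (Sum.inl 1)))) (mul_mem_box (pow_mem_box (hy 0) (d (Sum.inr 0)))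
    (pow_mem_box (hy 1) (d (Sum.inr 1))))
  simpa using this

theorem aevalAeval_chart (s t : k) (f : S k) :
    aevalAeval s t (chart u e v e' f) =
      MvPolynomial.aeval (Sum.elim (fun n => u n + e n * s) (fun n => v n + e' n * t)) f := by
  rw [← AlgHom.comp_apply]
  congr 1
  refine MvPolynomial.algHom_ext fun n => ?_
  rcases n with n | n
  · simp [chart_X_inl]
  · simp [chart_X_inr]

theorem originEval_chart (f : S k) :
    originEval k (chart u e v e' f) = MvPolynomial.aeval (Sum.elim u v) f := by
  rw [← AlgHom.comp_apply]
  congr 1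
  refine MvPolynomial.algHom_ext fun n => ?_
  rcases n with n | n
  · simp [chart_X_inl, originEval_apply]
  · simp [chart_X_inr, originEval_apply]

/-- Cramer's rule for `z` in the basis `u, e`, written as a scalar multiple of a point `u + s e` of
the chart. -/
theorem dual_coordinates {u₀ u₁ e₀ e₁ z₀ z₁ : k} (hu : e₁ * u₀ - e₀ * u₁ ≠ 0)
    (hz : e₁ * z₀ - e₀ * z₁ ≠ 0) :
    (e₁ * z₀ - e₀ * z₁) / (e₁ * u₀ - e₀ * u₁) *
      (u₀ + e₀ * ((u₀ * z₁ - u₁ * z₀) / (e₁ * z₀ - e₀ * z₁))) = z₀ ∧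
    (e₁ * z₀ - e₀ * z₁) / (e₁ * u₀ - e₀ * u₁) *
      (u₁ + e₁ * ((u₀ * z₁ - u₁ * z₀) / (e₁ * z₀ - e₀ * z₁))) = z₁ := by
  constructor <;>
  · rw [div_mul_eq_mul_div, div_eq_iff hu, mul_add, mul_left_comm, mul_div_cancel₀ _ hz]
    ring

theorem chart_injOn [Infinite k] (hu : e 1 * u 0 - e 0 * u 1 ≠ 0)
    (hv : e' 1 * v 0 - e' 0 * v 1 ≠ 0) {i j : ℕ} {f : S k} (hf : f ∈ bigrading k (i, j))
    (h : chart u e v e' f = 0) : f = 0 := by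
  -- Off the two lines at infinity every `z` is a bi-rescaling of a chart point, where `f` vanishes.
  -- Multiplying by the equations of these lines gives a polynomial that vanishes everywhere.
  have h1 : lineForm e Sum.inl * lineForm e' Sum.inr * f = 0 := by
    refine MvPolynomial.funext fun z => ?_
    rw [map_mul, map_mul, map_zero]
    by_cases h2 : MvPolynomial.eval z (lineForm e Sum.inl) = 0
    · rw [h2, zero_mul, zero_mul]
    by_cases h3 : MvPolynomial.eval z (lineForm e' Sum.inr) = 0
    · rw [h3, mul_zero, zero_mul]
    simp only [lineForm, map_sub, map_mul, MvPolynomial.eval_C, MvPolynomial.eval_X] at h2 h3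
    have h4 := aeval_mul_of_mem hf
      (fun n => u n + e n * ((u 0 * z (Sum.inl 1) - u 1 * z (Sum.inl 0)) /
        (e 1 * z (Sum.inl 0) - e 0 * z (Sum.inl 1))))
      (fun n => v n + e' n * ((v 0 * z (Sum.inr 1) - v 1 * z (Sum.inr 0)) /
        (e' 1 * z (Sum.inr 0) - e' 0 * z (Sum.inr 1))))
      ((e 1 * z (Sum.inl 0) - e 0 * z (Sum.inl 1)) / (e 1 * u 0 - e 0 * u 1))
      ((e' 1 * z (Sum.inr 0) - e' 0 * z (Sum.inr 1)) / (e' 1 * v 0 - e' 0 * v 1))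
    rw [← aevalAeval_chart, h, map_zero, mul_zero] at h4
    rw [← MvPolynomial.coe_aeval_eq_eval, RingHom.coe_coe]
    convert mul_zero _
    rw [← h4]
    congr 2
    obtain ⟨h5, h6⟩ := dual_coordinates hu h2
    obtain ⟨h7, h8⟩ := dual_coordinates hv h3
    ext (n | n) <;> fin_cases n
    exacts [h5.symm, h6.symm, h7.symm, h8.symm]
  rcases mul_eq_zero.1 h1 with h2 | h2
  · exfalso
    rcases mul_eq_zero.1 h2 with h3 | h3
    · apply hu
      simpa [lineForm] using congrArg (MvPolynomial.eval (Sum.elim u v)) h3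
    · apply hv
      simpa [lineForm] using congrArg (MvPolynomial.eval (Sum.elim u v)) h3
  · exact h2

/-- The linear forms that are dual to a basis `u, e` of `k²`. -/
theorem exists_dual_forms (hu : e 1 * u 0 - e 0 * u 1 ≠ 0) (hv : e' 1 * v 0 - e' 0 * v 1 ≠ 0) :
    chart u e v e' (MvPolynomial.C (e 1 * u 0 - e 0 * u 1)⁻¹ * lineForm e Sum.inl) = 1 ∧
    chart u e v e' (MvPolynomial.C (-(e 1 * u 0 - e 0 * u 1)⁻¹) * lineForm u Sum.inl) = C X ∧
    chart u e v e' (MvPolynomial.C (e' 1 * v 0 - e' 0 * v 1)⁻¹ * lineForm e' Sum.inr) = 1 ∧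
    chart u e v e' (MvPolynomial.C (-(e' 1 * v 0 - e' 0 * v 1)⁻¹) * lineForm v Sum.inr) = X := by
  have hC : ∀ c : k, chart u e v e' (MvPolynomial.C c) = C (C c) := fun c =>
    (chart u e v e').commutes c
  have e1 : (C (C (e 1 * u 0 - e 0 * u 1)⁻¹) * C (C (e 1 * u 0 - e 0 * u 1)) : k[X][X]) = 1 := by
    rw [← C_mul, ← C_mul, inv_mul_cancel₀ hu, C_1, C_1]
  have e2 : (C (C (e' 1 * v 0 - e' 0 * v 1)⁻¹) * C (C (e' 1 * v 0 - e' 0 * v 1)) : k[X][X]) = 1 := by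
    rw [← C_mul, ← C_mul, inv_mul_cancel₀ hv, C_1, C_1]
  simp only [C_sub, C_mul] at e1 e2
  simp only [lineForm, map_mul, map_sub, hC, chart_X_inl, chart_X_inr, C_neg, C_add]
  refine ⟨?_, ?_, ?_, ?_⟩
  · linear_combination e1
  · linear_combination (C X : k[X][X]) * e1
  · linear_combination e2
  · linear_combination (X : k[X][X]) * e2

/-- A chart of `ℙ¹ × ℙ¹` together with the forms that it maps to `1`, `s`, `1`, `t`. -/
structure IsChart (ψ : S k →ₐ[k] k[X][X]) (x x' y y' : S k) : Prop where
  x_mem : x ∈ bigrading k (1, 0)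
  x'_mem : x' ∈ bigrading k (1, 0)
  y_mem : y ∈ bigrading k (0, 1)
  y'_mem : y' ∈ bigrading k (0, 1)
  xy_mem : x * y ∈ irrelevant k
  map_x : ψ x = 1
  map_x' : ψ x' = C X
  map_y : ψ y = 1
  map_y' : ψ y' = X
  map_mem : ∀ i j, ∀ f ∈ bigrading k (i, j), ψ f ∈ box k (i + 1) (j + 1)
  injOn : ∀ i j, ∀ f ∈ bigrading k (i, j), ψ f = 0 → f = 0

theorem X_mul_X_mem_irrelevant (i j : Fin 2) :
    (MvPolynomial.X (Sum.inl i) * MvPolynomial.X (Sum.inr j) : S k) ∈ irrelevant k :=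
  Ideal.subset_span ⟨(i, j), rfl⟩

theorem lineForm_mul_mem_irrelevant (e e' : Fin 2 → k) :
    (lineForm e Sum.inl * lineForm e' Sum.inr : S k) ∈ irrelevant k := by
  have h : (lineForm e Sum.inl * lineForm e' Sum.inr : S k) =
      MvPolynomial.C (e 1 * e' 1) * (MvPolynomial.X (Sum.inl 0) * MvPolynomial.X (Sum.inr 0)) -
      MvPolynomial.C (e 1 * e' 0) * (MvPolynomial.X (Sum.inl 0) * MvPolynomial.X (Sum.inr 1)) -
      MvPolynomial.C (e 0 * e' 1) * (MvPolynomial.X (Sum.inl 1) * MvPolynomial.X (Sum.inr 0)) +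
      MvPolynomial.C (e 0 * e' 0) * (MvPolynomial.X (Sum.inl 1) * MvPolynomial.X (Sum.inr 1)) := by
    simp only [lineForm, MvPolynomial.C_mul]
    ring
  rw [h]
  have hm := fun (c : k) i j => (irrelevant k).mul_mem_left (MvPolynomial.C c)
    (X_mul_X_mem_irrelevant (k := k) i j)
  exact add_mem (sub_mem (sub_mem (hm _ _ _) (hm _ _ _)) (hm _ _ _)) (hm _ _ _)

theorem isChart_chart [Infinite k] (hu : e 1 * u 0 - e 0 * u 1 ≠ 0)
    (hv : e' 1 * v 0 - e' 0 * v 1 ≠ 0) :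
    IsChart (chart u e v e')
      (MvPolynomial.C (e 1 * u 0 - e 0 * u 1)⁻¹ * lineForm e Sum.inl)
      (MvPolynomial.C (-(e 1 * u 0 - e 0 * u 1)⁻¹) * lineForm u Sum.inl)
      (MvPolynomial.C (e' 1 * v 0 - e' 0 * v 1)⁻¹ * lineForm e' Sum.inr)
      (MvPolynomial.C (-(e' 1 * v 0 - e' 0 * v 1)⁻¹) * lineForm v Sum.inr) where
  x_mem := MvPolynomial.IsWeightedHomogeneous.C_mul (lineForm_inl_mem _) _
  x'_mem := MvPolynomial.IsWeightedHomogeneous.C_mul (lineForm_inl_mem _) _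
  y_mem := MvPolynomial.IsWeightedHomogeneous.C_mul (lineForm_inr_mem _) _
  y'_mem := MvPolynomial.IsWeightedHomogeneous.C_mul (lineForm_inr_mem _) _
  xy_mem := by
    rw [mul_mul_mul_comm]
    exact Ideal.mul_mem_left _ _ (lineForm_mul_mem_irrelevant e e')
  map_x := (exists_dual_forms hu hv).1
  map_x' := (exists_dual_forms hu hv).2.1
  map_y := (exists_dual_forms hu hv).2.2.1
  map_y' := (exists_dual_forms hu hv).2.2.2
  map_mem _ _ _ hf := chart_mem_box hf
  injOn _ _ _ hf h := chart_injOn hu hv hf h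

namespace IsChart

variable {ψ : S k →ₐ[k] k[X][X]} {x x' y y' : S k}

theorem map_bigrading (hψ : IsChart ψ x x' y y') (i j : ℕ) :
    (bigrading k (i, j)).map ψ.toLinearMap = box k (i + 1) (j + 1) := by
  refine le_antisymm ?_ fun f hf => ?_
  · rintro _ ⟨f, hf, rfl⟩
    exact hψ.map_mem i j f hf
  · rw [f.as_sum_support]
    refine Submodule.sum_mem _ fun b _ => ?_
    rw [(f.coeff b).as_sum_support, map_sum]
    refine Submodule.sum_mem _ fun a ha => ?_
    obtain ⟨ha, hb⟩ := hf a b (mem_support_iff.1 ha)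
    refine ⟨((f.coeff b).coeff a) • (x' ^ a * x ^ (i - a) * (y' ^ b * y ^ (j - b))),
      Submodule.smul_mem _ _ ?_, ?_⟩
    · have h := mul_mem_bigrading
        (mul_mem_bigrading (pow_mem_bigrading hψ.x'_mem a) (pow_mem_bigrading hψ.x_mem (i - a)))
        (mul_mem_bigrading (pow_mem_bigrading hψ.y'_mem b) (pow_mem_bigrading hψ.y_mem (j - b)))
      have e1 : a * 1 + (i - a) * 1 + (b * 0 + (j - b) * 0) = i := by omega
      have e2 : a * 0 + (i - a) * 0 + (b * 1 + (j - b) * 1) = j := by omega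
      rwa [e1, e2] at h
    · simp only [AlgHom.toLinearMap_apply, map_smul, map_mul, map_pow, hψ.map_x, hψ.map_x',
        hψ.map_y, hψ.map_y', one_pow, mul_one]
      rw [← C_mul_X_pow_eq_monomial, ← C_mul_X_pow_eq_monomial, C_mul, C_pow, mul_assoc,
        Algebra.smul_def]
      rfl

theorem exists_eq (hψ : IsChart ψ x x' y y') {i j : ℕ} {f : k[X][X]}
    (hf : f ∈ box k (i + 1) (j + 1)) : ∃ F ∈ bigrading k (i, j), ψ F = f := by
  rw [← hψ.map_bigrading] at hf
  exact hf

theorem surjective (hψ : IsChart ψ x x' y y') : Function.Surjective ψ := by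
  intro f
  obtain ⟨n, hn⟩ := exists_mem_box f
  obtain ⟨F, _, hF⟩ := hψ.exists_eq (box_mono (Nat.le_succ n) (Nat.le_succ n) hn)
  exact ⟨F, hF⟩

/-- Homogenisation: each component of `F` is padded with powers of `x` and `y`, which the chart
sends to 1. -/
theorem exists_form_of_mem (hψ : IsChart ψ x x' y y') {J : Ideal (S k)}
    (hJ : J.IsHomogeneous (bigrading k)) {F : S k} (hF : F ∈ J) :
    ∃ N, ∀ n, N ≤ n → ∃ G ∈ bigrading k (n, n), G ∈ J ∧ ψ G = ψ F := by
  classical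
  obtain ⟨s, hs⟩ := sum_decompose F
  rw [hs]
  clear hs
  induction s using Finset.induction_on with
  | empty => exact ⟨0, fun n _ => ⟨0, Submodule.zero_mem _, J.zero_mem, by simp⟩⟩
  | insert d s hd ih =>
    obtain ⟨N, hN⟩ := ih
    refine ⟨max N (max d.1 d.2), fun n hn => ?_⟩
    obtain ⟨G, hG, hGJ, hψG⟩ := hN n (by omega)
    set Fd : S k := (DirectSum.decompose (bigrading k) F d : S k)
    have h := mul_mem_bigrading
        (mul_mem_bigrading (pow_mem_bigrading hψ.x_mem (n - d.1))
          (pow_mem_bigrading hψ.y_mem (n - d.2))) (decompose_mem F d)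
    have e1 : (n - d.1) * 1 + (n - d.2) * 0 + d.1 = n := by omega
    have e2 : (n - d.1) * 0 + (n - d.2) * 1 + d.2 = n := by omega
    rw [e1, e2] at h
    refine ⟨x ^ (n - d.1) * y ^ (n - d.2) * Fd + G, add_mem h hG,
      J.add_mem (J.mul_mem_left _ (hJ d hF)) hGJ, ?_⟩
    rw [Finset.sum_insert hd, map_add, map_add, hψG]
    simp [hψ.map_x, hψ.map_y, Fd]

/-- Dehomogenising loses only powers of `x` and `y`, and these do not vanish at any point of the
support. -/
theorem mem_saturation_iff [IsAlgClosed k] (hψ : IsChart ψ x x' y y') {J : Ideal (S k)}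
    (hJ : J.IsHomogeneous (bigrading k))
    (hsupp : ∀ Q ∈ support J, x ∉ pointIdeal Q ∧ y ∉ pointIdeal Q) {i j : ℕ} {f : S k}
    (hf : f ∈ bigrading k (i, j)) : f ∈ saturation J ↔ ψ f ∈ J.map ψ := by
  constructor
  · rintro ⟨n, hn⟩
    have := Ideal.mem_map_of_mem ψ (hn _ (Ideal.pow_mem_pow hψ.xy_mem n))
    simpa [hψ.map_x, hψ.map_y] using this
  · intro h
    obtain ⟨F, hF, hFf⟩ := (Ideal.mem_map_iff_of_surjective _ hψ.surjective).1 h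
    obtain ⟨N, hN⟩ := hψ.exists_form_of_mem hJ hF
    obtain ⟨n, hNn, hin, hjn⟩ : ∃ n, N ≤ n ∧ i ≤ n ∧ j ≤ n :=
      ⟨max N (max i j), by omega, by omega, by omega⟩
    obtain ⟨G, hG, hGJ, hψG⟩ := hN n hNn
    have h' := mul_mem_bigrading
        (mul_mem_bigrading (pow_mem_bigrading hψ.x_mem (n - i))
          (pow_mem_bigrading hψ.y_mem (n - j))) hf
    have e1 : (n - i) * 1 + (n - j) * 0 + i = n := by omega
    have e2 : (n - i) * 0 + (n - j) * 1 + j = n := by omega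
    rw [e1, e2] at h'
    have heq : x ^ (n - i) * y ^ (n - j) * f = G := by
      rw [← sub_eq_zero]
      refine hψ.injOn n n _ (sub_mem h' hG) ?_
      rw [map_sub, hψG, hFf]
      simp [hψ.map_x, hψ.map_y]
    refine mem_saturation_of_local hJ hf fun Q hQ => ⟨x ^ (n - i) * y ^ (n - j), fun hm => ?_, ?_⟩
    · exact ((pointIdeal_isPrime Q).mem_or_mem hm).elim
        (fun h => (hsupp Q hQ).1 ((pointIdeal_isPrime Q).mem_of_pow_mem _ h))
        (fun h => (hsupp Q hQ).2 ((pointIdeal_isPrime Q).mem_of_pow_mem _ h))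
    · rw [heq]; exact hGJ

end IsChart

/-! ### Hilbert functions and degrees computed in a chart. -/

theorem finrank_map_eq_of_forall {V W W' : Type*} [AddCommGroup V] [Module k V] [AddCommGroup W]
    [Module k W] [AddCommGroup W'] [Module k W'] (f : V →ₗ[k] W) (g : V →ₗ[k] W')
    (p : Submodule k V) (h : ∀ v ∈ p, f v = 0 ↔ g v = 0) :
    Module.finrank k (p.map f) = Module.finrank k (p.map g) := by
  rw [← LinearMap.range_domRestrict, ← LinearMap.range_domRestrict]
  have hker : LinearMap.ker (f.domRestrict p) = LinearMap.ker (g.domRestrict p) := by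
    ext v
    exact h v v.2
  exact ((f.domRestrict p).quotKerEquivRange.symm.trans
    ((Submodule.quotEquivOfEq _ _ hker).trans (g.domRestrict p).quotKerEquivRange)).finrank_eq

theorem IsChart.hilbert_saturation [IsAlgClosed k] {ψ : S k →ₐ[k] k[X][X]} {x x' y y' : S k}
    (hψ : IsChart ψ x x' y y') {J : Ideal (S k)} (hJ : J.IsHomogeneous (bigrading k))
    (hsupp : ∀ Q ∈ support J, x ∉ pointIdeal Q ∧ y ∉ pointIdeal Q) (i j : ℕ) :
    hilbert (saturation J) ((i : ℤ) - 1) ((j : ℤ) - 1) = boxHilbert (J.map ψ) i j := by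
  have hz : ∀ i j : ℕ, i = 0 ∨ j = 0 → box k i j = ⊥ := by
    intro i j hij
    rw [Submodule.eq_bot_iff]
    intro f hf
    ext b a
    by_contra h
    have := hf a b h
    omega
  -- Empty boxes match the convention that `M` vanishes in degree `-1`.
  rcases i with _ | i
  · rw [show hilbert (saturation J) (((0 : ℕ) : ℤ) - 1) ((j : ℤ) - 1) = 0 from if_neg (by simp),
      boxHilbert, hz 0 j (Or.inl rfl)]
    rw [Submodule.map_bot]
    simp
  rcases j with _ | j
  · rw [show hilbert (saturation J) (((i + 1 : ℕ) : ℤ) - 1) (((0 : ℕ) : ℤ) - 1) = 0 from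
      if_neg (by simp), boxHilbert, hz (i + 1) 0 (Or.inr rfl)]
    rw [Submodule.map_bot]
    simp
  rw [hilbert, if_pos (by constructor <;> simp), boxHilbert, ← hψ.map_bigrading,
    ← Submodule.map_comp]
  have e1 : ((((i + 1 : ℕ) : ℤ) - 1).toNat, (((j + 1 : ℕ) : ℤ) - 1).toNat) = (i, j) := by simp
  rw [e1]
  congr 1
  refine finrank_map_eq_of_forall _ _ _ fun f hf => ?_
  simp only [AlgHom.toLinearMap_apply, LinearMap.comp_apply, Ideal.Quotient.mkₐ_eq_mk,
    Ideal.Quotient.eq_zero_iff_mem]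
  exact hψ.mem_saturation_iff hJ hsupp hf

theorem IsChart.degree_saturation [IsAlgClosed k] {ψ : S k →ₐ[k] k[X][X]} {x x' y y' : S k}
    (hψ : IsChart ψ x x' y y') {J : Ideal (S k)} (hJ : J.IsHomogeneous (bigrading k))
    (hsupp : ∀ Q ∈ support J, x ∉ pointIdeal Q ∧ y ∉ pointIdeal Q)
    (hfin : Module.Finite k (k[X][X] ⧸ J.map ψ)) :
    degree (saturation J) = Module.finrank k (k[X][X] ⧸ J.map ψ) := by
  obtain ⟨n, hn⟩ := exists_boxHilbert_eq (J.map ψ)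
  have hlarge : ∀ i j : ℤ, n ≤ i → n ≤ j →
      hilbert (saturation J) i j = Module.finrank k (k[X][X] ⧸ J.map ψ) := by
    intro i j hi hj
    obtain ⟨i, rfl⟩ := Int.eq_ofNat_of_zero_le ((Int.natCast_nonneg n).trans hi)
    obtain ⟨j, rfl⟩ := Int.eq_ofNat_of_zero_le ((Int.natCast_nonneg n).trans hj)
    rw [← hn (i + 1) (j + 1) (by omega) (by omega), ← hψ.hilbert_saturation hJ hsupp]
    simp
  have hset : {d : ℕ | ∃ n : ℤ, ∀ i j : ℤ, n ≤ i → n ≤ j → hilbert (saturation J) i j = d} =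
      {Module.finrank k (k[X][X] ⧸ J.map ψ)} := by
    ext d
    constructor
    · rintro ⟨m, hm⟩
      have h1 := hm (max m n) (max m n) (le_max_left _ _) (le_max_left _ _)
      rw [hlarge _ _ (le_max_right _ _) (le_max_right _ _)] at h1
      exact (Int.natCast_inj.1 h1).symm
    · rintro rfl
      exact ⟨n, hlarge⟩
  rw [degree, hset, csInf_singleton]

/-! ### A chart around the support, and forms of pure bidegree in the ideal. -/

theorem exists_avoiding [Infinite k] (T : Finset (Projectivization k (Fin 2 → k))) :
    ∃ e : Fin 2 → k, ∀ Q ∈ T, e 1 * Q.rep 0 - e 0 * Q.rep 1 ≠ 0 := by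
  classical
  -- The point `[1 : c]` must avoid finitely many slopes; a point with `Q.rep 0 = 0` is never of
  -- this form.
  obtain ⟨c, hc⟩ := Infinite.exists_notMem_finset (T.image fun Q => Q.rep 1 / Q.rep 0)
  refine ⟨![1, c], fun Q hQ h => ?_⟩
  simp only [Matrix.cons_val_one, Matrix.cons_val_zero, one_mul] at h
  by_cases h0 : Q.rep 0 = 0
  · refine Q.rep_nonzero ?_
    ext n
    fin_cases n
    · exact h0
    · simpa [h0] using h
  · refine hc (Finset.mem_image.2 ⟨Q, hQ, ?_⟩)
    rw [div_eq_iff h0]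
    linear_combination -h

theorem exists_chart [IsAlgClosed k] {T : Set (Point k)} (hT : T.Finite) {P : Point k}
    (hP : P ∈ T) : ∃ (ψ : S k →ₐ[k] k[X][X]) (x x' y y' : S k), IsChart ψ x x' y y' ∧
      (∀ Q ∈ T, x ∉ pointIdeal Q ∧ y ∉ pointIdeal Q) ∧
      ∀ f, originEval k (ψ f) = evalAt P f := by
  classical
  have : Infinite k := IsAlgClosed.instInfinite
  obtain ⟨e, he⟩ := exists_avoiding (hT.toFinset.image Prod.fst)
  obtain ⟨e', he'⟩ := exists_avoiding (hT.toFinset.image Prod.snd)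
  have he : ∀ Q ∈ T, e 1 * Q.1.rep 0 - e 0 * Q.1.rep 1 ≠ 0 := fun Q hQ =>
    he Q.1 (Finset.mem_image_of_mem _ (hT.mem_toFinset.2 hQ))
  have he' : ∀ Q ∈ T, e' 1 * Q.2.rep 0 - e' 0 * Q.2.rep 1 ≠ 0 := fun Q hQ =>
    he' Q.2 (Finset.mem_image_of_mem _ (hT.mem_toFinset.2 hQ))
  have hψ := isChart_chart (he P hP) (he' P hP)
  refine ⟨_, _, _, _, _, hψ, fun Q hQ => ?_, fun f => originEval_chart f⟩
  rw [mem_pointIdeal_iff hψ.x_mem, mem_pointIdeal_iff hψ.y_mem]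
  constructor
  · simpa [evalAt, lineForm] using ⟨he P hP, he Q hQ⟩
  · simpa [evalAt, lineForm] using ⟨he' P hP, he' Q hQ⟩

theorem lineForm_ne_zero {e : Fin 2 → k} (he : e ≠ 0) {ι : Fin 2 → Fin 2 ⊕ Fin 2}
    (hι : Function.Injective ι) : (lineForm e ι : S k) ≠ 0 := by
  intro h
  apply he
  have h1 := congrArg (MvPolynomial.eval fun n => if n = ι 0 then 1 else 0) h
  have h2 := congrArg (MvPolynomial.eval fun n => if n = ι 1 then 1 else 0) h
  have h01 : ι 0 ≠ ι 1 := fun h => zero_ne_one (hι h)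
  simp [lineForm, h01, h01.symm] at h1 h2
  ext n
  fin_cases n
  · exact h2
  · exact h1

/-- A zero-dimensional scheme lies on a union of multiple lines of either ruling. -/
theorem ZeroDimScheme.exists_form_inl [IsAlgClosed k] (X : ZeroDimScheme k) :
    ∃ n : ℕ, ∃ f ∈ X.ideal, f ∈ bigrading k (n, 0) ∧ f ≠ 0 := by
  classical
  set T := X.finite_support.toFinset
  set h : S k := ∏ Q ∈ T, lineForm Q.1.rep Sum.inl
  have hh : h ∈ bigrading k (∑ _Q ∈ T, (1, 0)) :=
    prod_mem_bigrading T _ _ fun Q _ => lineForm_inl_mem _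
  have e : ∑ _Q ∈ T, ((1, 0) : ℕ × ℕ) = (T.card, 0) := by simp [Finset.sum_const]
  rw [e] at hh
  obtain ⟨n, hn⟩ := pow_mem_saturation X.homogeneous hh fun Q hQ => by
    refine Ideal.mem_of_dvd _ (Finset.dvd_prod_of_mem _ (X.finite_support.mem_toFinset.2 hQ)) ?_
    rw [mem_pointIdeal_iff (lineForm_inl_mem _)]
    simp [evalAt, lineForm, mul_comm]
  refine ⟨n * T.card, h ^ n, X.saturated hn, pow_mem_bigrading hh n, pow_ne_zero _ ?_⟩
  exact Finset.prod_ne_zero_iff.2 fun Q _ => lineForm_ne_zero Q.1.rep_nonzero Sum.inl_injective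

theorem ZeroDimScheme.exists_form_inr [IsAlgClosed k] (X : ZeroDimScheme k) :
    ∃ n : ℕ, ∃ f ∈ X.ideal, f ∈ bigrading k (0, n) ∧ f ≠ 0 := by
  classical
  set T := X.finite_support.toFinset
  set h : S k := ∏ Q ∈ T, lineForm Q.2.rep Sum.inr
  have hh : h ∈ bigrading k (∑ _Q ∈ T, (0, 1)) :=
    prod_mem_bigrading T _ _ fun Q _ => lineForm_inr_mem _
  have e : ∑ _Q ∈ T, ((0, 1) : ℕ × ℕ) = (0, T.card) := by simp [Finset.sum_const]
  rw [e] at hh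
  obtain ⟨n, hn⟩ := pow_mem_saturation X.homogeneous hh fun Q hQ => by
    refine Ideal.mem_of_dvd _ (Finset.dvd_prod_of_mem _ (X.finite_support.mem_toFinset.2 hQ)) ?_
    rw [mem_pointIdeal_iff (lineForm_inr_mem _)]
    simp [evalAt, lineForm, mul_comm]
  refine ⟨n * T.card, h ^ n, X.saturated hn, pow_mem_bigrading hh n, pow_ne_zero _ ?_⟩
  exact Finset.prod_ne_zero_iff.2 fun Q _ => lineForm_ne_zero Q.2.rep_nonzero Sum.inr_injective

theorem ZeroDimScheme.exists_form_of_a [IsAlgClosed k] (X : ZeroDimScheme k) {q : ℕ}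
    (hq : (q : ℤ) = X.a) : ∃ f ∈ X.ideal, f ∈ bigrading k (q + 1, 0) ∧ f ≠ 0 := by
  have h := Nat.sInf_mem (s := {i : ℕ | ∃ f ∈ X.ideal, f ∈ bigrading k (i, 0) ∧ f ≠ 0})
    X.exists_form_inl
  rw [ZeroDimScheme.a] at hq
  rwa [show sInf {i : ℕ | ∃ f ∈ X.ideal, f ∈ bigrading k (i, 0) ∧ f ≠ 0} = q + 1 by omega] at h

theorem ZeroDimScheme.exists_form_of_b [IsAlgClosed k] (X : ZeroDimScheme k) {p : ℕ}
    (hp : (p : ℤ) = X.b) : ∃ f ∈ X.ideal, f ∈ bigrading k (0, p + 1) ∧ f ≠ 0 := by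
  have h := Nat.sInf_mem (s := {j : ℕ | ∃ f ∈ X.ideal, f ∈ bigrading k (0, j) ∧ f ≠ 0})
    X.exists_form_inr
  rw [ZeroDimScheme.b] at hp
  rwa [show sInf {j : ℕ | ∃ f ∈ X.ideal, f ∈ bigrading k (0, j) ∧ f ≠ 0} = p + 1 by omega] at h

/-! ### Exchange of the two rulings, and the lines through `P`. -/

/-- The image of an ideal of `k[s, t]` under the exchange of `s` and `t`. -/
def swapIdeal (K : Ideal k[X][X]) : Ideal k[X][X] :=
  K.map (Bivariate.swap (R := k) : k[X][X] ≃ₐ[k] k[X][X])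

theorem mem_swapIdeal {K : Ideal k[X][X]} {f : k[X][X]} :
    f ∈ swapIdeal K ↔ Bivariate.swap (R := k) f ∈ K := by
  rw [swapIdeal, Ideal.mem_map_iff_of_surjective _ (Bivariate.swap (R := k)).surjective]
  constructor
  · rintro ⟨g, hg, rfl⟩
    rwa [Bivariate.swap_swap_apply]
  · intro h
    exact ⟨_, h, Bivariate.swap_swap_apply f⟩

theorem hasSep_swapIdeal {K : Ideal k[X][X]} {i j : ℕ} :
    HasSep (swapIdeal K) j i ↔ HasSep K i j := by
  constructor
  · rintro ⟨f, hf, hfb, h0⟩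
    exact ⟨_, mem_swapIdeal.1 hf, swap_mem_box.2 hfb, by rwa [originEval_swap]⟩
  · rintro ⟨f, hf, hfb, h0⟩
    refine ⟨Bivariate.swap (R := k) f, mem_swapIdeal.2 ?_, swap_mem_box.2 hfb, by
      rwa [originEval_swap]⟩
    rwa [Bivariate.swap_swap_apply]

/-- The points of the scheme defined by `K` on the line `t = 0` are those of the scheme with
exchanged coordinates on the line `s = 0`. -/
def swapQuotientEquiv (K : Ideal k[X][X]) :
    (k[X][X] ⧸ (K ⊔ Ideal.span {X})) ≃ₐ[k] (k[X][X] ⧸ (swapIdeal K ⊔ Ideal.span {C X})) :=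
  Ideal.quotientEquivAlg _ _ Bivariate.swap (by
    have h := Ideal.map_sup (Bivariate.swap (R := k) : k[X][X] ≃ₐ[k] k[X][X]) K (Ideal.span {X})
    rw [Ideal.map_span, Set.image_singleton, Bivariate.swap_Y] at h
    exact h.symm)

theorem exists_eq_C_mul_X {δ : k[X]} (hδ : δ ≠ 0) (hd : δ.natDegree ≤ 1) (h0 : δ.coeff 0 = 0) :
    ∃ c : k, c ≠ 0 ∧ δ = C c * X := by
  obtain ⟨a, b, rfl⟩ := exists_eq_X_add_C_of_natDegree_le_one hd
  have hb : b = 0 := by simpa using h0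
  subst hb
  exact ⟨a, fun ha => hδ (by simp [ha]), by simp⟩

theorem sup_span_homogeneous {I : Ideal (S k)} (hI : I.IsHomogeneous (bigrading k)) {d : ℕ × ℕ}
    {R : S k} (hR : R ∈ bigrading k d) :
    (I ⊔ Ideal.span {R}).IsHomogeneous (bigrading k) :=
  hI.sup (Ideal.homogeneous_span _ _ (by rintro _ rfl; exact ⟨d, hR⟩))

namespace IsChart

variable {ψ : S k →ₐ[k] k[X][X]} {x x' y y' : S k}

theorem exists_map_eq_C (hψ : IsChart ψ x x' y y') {n : ℕ} {f : S k}
    (hf : f ∈ bigrading k (n, 0)) (h0 : f ≠ 0) :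
    ∃ δ : k[X], δ ≠ 0 ∧ δ.natDegree ≤ n ∧ ψ f = C δ := by
  obtain ⟨δ, hδ, h⟩ := exists_eq_C_of_mem_box (hψ.map_mem _ _ f hf)
  refine ⟨δ, fun hz => h0 (hψ.injOn _ _ f hf ?_), hδ, h⟩
  rw [h, hz, C_0]

theorem exists_map_eq_map_C (hψ : IsChart ψ x x' y y') {n : ℕ} {f : S k}
    (hf : f ∈ bigrading k (0, n)) (h0 : f ≠ 0) :
    ∃ δ : k[X], δ ≠ 0 ∧ δ.natDegree ≤ n ∧ ψ f = δ.map C := by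
  obtain ⟨δ, hδ, h⟩ := exists_eq_C_of_mem_box (swap_mem_box.2 (hψ.map_mem _ _ f hf))
  have h' : ψ f = δ.map C := by
    rw [← Bivariate.swap_C, ← h, Bivariate.swap_swap_apply]
  refine ⟨δ, fun hz => h0 (hψ.injOn _ _ f hf ?_), hδ, h'⟩
  rw [h', hz, Polynomial.map_zero]

/-- The equation becomes a nonzero polynomial in `s` of degree at most one vanishing at the origin,
that is, a unit times `s`. -/
theorem span_map_inl (hψ : IsChart ψ x x' y y') {R : S k} (hR : R ∈ bigrading k (1, 0))
    (hR0 : R ≠ 0) (hRP : originEval k (ψ R) = 0) :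
    (Ideal.span {R}).map ψ = Ideal.span {C X} := by
  obtain ⟨δ, hδ, hd, h⟩ := hψ.exists_map_eq_C hR hR0
  rw [h, originEval_apply, coeff_C_zero] at hRP
  obtain ⟨c, hc, rfl⟩ := exists_eq_C_mul_X hδ hd hRP
  rw [Ideal.map_span, Set.image_singleton, h, C_mul]
  exact Ideal.span_singleton_mul_left_unit (((isUnit_iff_ne_zero.2 hc).map C).map C) _

theorem span_map_inr (hψ : IsChart ψ x x' y y') {R : S k} (hR : R ∈ bigrading k (0, 1))
    (hR0 : R ≠ 0) (hRP : originEval k (ψ R) = 0) :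
    (Ideal.span {R}).map ψ = Ideal.span {X} := by
  obtain ⟨δ, hδ, hd, h⟩ := hψ.exists_map_eq_map_C hR hR0
  rw [h, originEval_apply, coeff_map, coeff_C_zero] at hRP
  obtain ⟨c, hc, rfl⟩ := exists_eq_C_mul_X hδ hd hRP
  rw [Ideal.map_span, Set.image_singleton, h, Polynomial.map_mul, map_C, map_X]
  exact Ideal.span_singleton_mul_left_unit (((isUnit_iff_ne_zero.2 hc).map C).map C) _

theorem numOnLine_eq [IsAlgClosed k] (hψ : IsChart ψ x x' y y') {I : Ideal (S k)}
    (hI : I.IsHomogeneous (bigrading k))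
    (hsupp : ∀ Q ∈ support I, x ∉ pointIdeal Q ∧ y ∉ pointIdeal Q) {d : ℕ × ℕ} {R : S k}
    (hR : R ∈ bigrading k d) {l : k[X][X]} (hl : (Ideal.span {R}).map ψ = Ideal.span {l})
    (hfin : Module.Finite k (k[X][X] ⧸ (I.map ψ ⊔ Ideal.span {l}))) :
    numOnLine I R = Module.finrank k (k[X][X] ⧸ (I.map ψ ⊔ Ideal.span {l})) := by
  have e : (I ⊔ Ideal.span {R}).map ψ = I.map ψ ⊔ Ideal.span {l} := by
    rw [Ideal.map_sup, hl]
  rw [← e] at hfin ⊢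
  exact hψ.degree_saturation (sup_span_homogeneous hI hR)
    (fun Q (hQ : I ⊔ Ideal.span {R} ≤ pointIdeal Q) => hsupp Q (le_sup_left.trans hQ)) hfin

end IsChart

/-! ### The bidegrees of separators and the comparison of Hilbert functions. -/

theorem saturation_eq (X : ZeroDimScheme k) : saturation X.ideal = X.ideal :=
  le_antisymm X.saturated (le_saturation _)

theorem IsChart.mem_ideal_iff [IsAlgClosed k] {ψ : S k →ₐ[k] k[X][X]} {x x' y y' : S k}
    (hψ : IsChart ψ x x' y y') (X : ZeroDimScheme k)
    (hsupp : ∀ Q ∈ support X.ideal, x ∉ pointIdeal Q ∧ y ∉ pointIdeal Q) {i j : ℕ} {f : S k}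
    (hf : f ∈ bigrading k (i, j)) : f ∈ X.ideal ↔ ψ f ∈ X.ideal.map ψ := by
  rw [← hψ.mem_saturation_iff X.homogeneous hsupp hf, saturation_eq]

/-- A separator of bidegree `(i, j)` is a polynomial in the box that lies in the ideal of the other
components and does not vanish at the origin of the chart. -/
theorem IsChart.hasSep_iff [IsAlgClosed k] {ψ : S k →ₐ[k] k[X][X]} {x x' y y' : S k}
    (hψ : IsChart ψ x x' y y') (X : ZeroDimScheme k) (P : Point k)
    (hsupp : ∀ Q ∈ support X.ideal, x ∉ pointIdeal Q ∧ y ∉ pointIdeal Q)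
    (hP : ∀ f, originEval k (ψ f) = evalAt P f) (i j : ℕ) :
    HasSep ((X.erase P).ideal.map ψ) (i + 1) (j + 1) ↔ ∃ f, X.IsSeparator P i j f := by
  have hsupp' : ∀ Q ∈ support (X.erase P).ideal, x ∉ pointIdeal Q ∧ y ∉ pointIdeal Q :=
    fun Q hQ => hsupp Q ((le_eraseIdeal X.ideal P).trans hQ)
  constructor
  · rintro ⟨g, hg, hgb, h0⟩
    obtain ⟨f, hf, rfl⟩ := hψ.exists_eq hgb
    refine ⟨f, hf, ?_, mem_eraseIdeal.1 ((hψ.mem_ideal_iff (X.erase P) hsupp' hf).2 hg)⟩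
    rwa [mem_pointIdeal_iff hf, ← hP]
  · rintro ⟨f, hf, hfP, hfc⟩
    rw [mem_pointIdeal_iff hf, ← hP] at hfP
    exact ⟨ψ f, Ideal.mem_map_of_mem _ (mem_eraseIdeal.2 hfc), hψ.map_mem _ _ f hf, hfP⟩

/-- The separators of a point of multiplicity one are those of bidegree at least `(q, p)`. -/
theorem exists_separator_iff [IsAlgClosed k]
    (X : ZeroDimScheme k) (P : Point k) (hPX : P ∈ support X.ideal)
    (hP : multiplicity X.ideal P = 1) (R C : S k)
    (hR : R ∈ bigrading k (1, 0)) (hR0 : R ≠ 0) (hRP : R ∈ pointIdeal P)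
    (hC : C ∈ bigrading k (0, 1)) (hC0 : C ≠ 0) (hCP : C ∈ pointIdeal P)
    (p q : ℕ) (hp : p = numOnLine (X.erase P).ideal R) (hq : q = numOnLine (X.erase P).ideal C)
    (h : (p : ℤ) = X.b ∨ (q : ℤ) = X.a ∨
      ∀ i j : ℤ, (q : ℤ) + 1 ≤ i → (p : ℤ) + 1 ≤ j → X.ΔM i j = 0) :
    (∀ i j : ℕ, (∃ f, X.IsSeparator P i j f) ↔ q ≤ i ∧ p ≤ j) ∧
    ∀ i j : ℤ, X.M i j = (X.erase P).M i j + if (q : ℤ) ≤ i ∧ (p : ℤ) ≤ j then 1 else 0 := by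
  classical
  obtain ⟨ψ, x, x', y, y', hψ, hsupp, hP0⟩ := exists_chart X.finite_support hPX
  set Z := X.erase P
  have hsupp' : ∀ Q ∈ support Z.ideal, x ∉ pointIdeal Q ∧ y ∉ pointIdeal Q :=
    fun Q hQ => hsupp Q ((le_eraseIdeal X.ideal P).trans hQ)
  set K := Z.ideal.map ψ
  -- Every polynomial is the image of a form, so the description of the forms of `I(X)` transfers to
  -- the chart.
  have hKX : ∀ g, g ∈ X.ideal.map ψ ↔ g ∈ K ∧ originEval k g = 0 := by
    intro g
    obtain ⟨n, hn⟩ := exists_mem_box g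
    obtain ⟨f, hf, rfl⟩ := hψ.exists_eq (box_mono (Nat.le_succ n) (Nat.le_succ n) hn)
    rw [← hψ.mem_ideal_iff X hsupp hf, ← hψ.mem_ideal_iff Z hsupp' hf, hP0,
      ← mem_pointIdeal_iff hf]
    exact mem_ideal_iff_of_multiplicity_one hPX hP hf
  obtain ⟨d, f₀, hf₀, hf₀Z, hf₀P⟩ := exists_form_notMem Z.homogeneous (eraseIdeal_not_le X P)
  have hg₀ : ψ f₀ ∈ K := Ideal.mem_map_of_mem _ hf₀Z
  have hg₀0 : originEval k (ψ f₀) ≠ 0 := by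
    rwa [hP0, Ne, ← mem_pointIdeal_iff hf₀]
  have hs₀ : Bivariate.swap (R := k) (ψ f₀) ∈ swapIdeal K := by
    rwa [mem_swapIdeal, Bivariate.swap_swap_apply]
  have hs₀0 : originEval k (Bivariate.swap (R := k) (ψ f₀)) ≠ 0 := by rwa [originEval_swap]
  have hpK : p = Module.finrank k (k[X][X] ⧸ (K ⊔ Ideal.span {Polynomial.C Polynomial.X})) := by
    obtain ⟨_, _, hfin, _⟩ := exists_generator K hg₀ hg₀0
    rw [hp]
    exact hψ.numOnLine_eq Z.homogeneous hsupp' hR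
      (hψ.span_map_inl hR hR0 (by rwa [hP0, ← mem_pointIdeal_iff hR])) hfin
  have hqK : q = Module.finrank k
      (k[X][X] ⧸ (swapIdeal K ⊔ Ideal.span {Polynomial.C Polynomial.X})) := by
    obtain ⟨_, _, hfin, _⟩ := exists_generator (swapIdeal K) hs₀ hs₀0
    have hfin' := Module.Finite.equiv (swapQuotientEquiv K).symm.toLinearEquiv
    rw [hq, ← (swapQuotientEquiv K).toLinearEquiv.finrank_eq]
    exact hψ.numOnLine_eq Z.homogeneous hsupp' hC
      (hψ.span_map_inr hC hC0 (by rwa [hP0, ← mem_pointIdeal_iff hC])) hfin'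
  obtain ⟨n₁, g₁, hg₁, hg₁b, hg₁0⟩ := Z.exists_form_inl
  obtain ⟨δ₁, hδ₁, -, hδ₁g⟩ := hψ.exists_map_eq_C hg₁b hg₁0
  obtain ⟨n₂, g₂, hg₂, hg₂b, hg₂0⟩ := Z.exists_form_inr
  obtain ⟨δ₂, hδ₂, -, hδ₂g⟩ := hψ.exists_map_eq_map_C hg₂b hg₂0
  obtain ⟨hlow₁, i₀, hi₀⟩ := hasSep_of_line hδ₁
    (hδ₁g ▸ Ideal.mem_map_of_mem ψ hg₁ : Polynomial.C δ₁ ∈ K) hg₀ hg₀0 hpK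
  obtain ⟨hlow₂, j₀, hj₀⟩ := hasSep_of_line (K := swapIdeal K) hδ₂
    (by rw [mem_swapIdeal, Bivariate.swap_C, ← hδ₂g]; exact Ideal.mem_map_of_mem ψ hg₂)
    hs₀ hs₀0 hqK
  rw [hasSep_swapIdeal] at hj₀
  have hMX := hψ.hilbert_saturation X.homogeneous hsupp
  have hMZ := hψ.hilbert_saturation Z.homogeneous hsupp'
  rw [saturation_eq] at hMX hMZ
  have hsep : HasSep K (q + 1) (p + 1) := by
    rcases h with h | h | h
    -- Here `γ(t)` has degree at most `b + 1 = p + 1`. It lies in `K` and vanishes at the origin, so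
    -- reducing a separator of `s`-degree at most `q` modulo `γ` keeps its value there.
    · obtain ⟨g, hg, hgb, hg0⟩ := X.exists_form_of_b h
      obtain ⟨γ, hγ, hd, hγg⟩ := hψ.exists_map_eq_map_C hgb hg0
      obtain ⟨h1, h2⟩ := (hKX _).1 (Ideal.mem_map_of_mem ψ hg)
      rw [hγg] at h1 h2
      exact HasSep.of_dvd hγ h1 h2 hd hj₀
    · obtain ⟨g, hg, hgb, hg0⟩ := X.exists_form_of_a h
      obtain ⟨γ, hγ, hd, hγg⟩ := hψ.exists_map_eq_C hgb hg0
      obtain ⟨h1, h2⟩ := (hKX _).1 (Ideal.mem_map_of_mem ψ hg)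
      rw [hγg] at h1 h2
      rw [← hasSep_swapIdeal]
      refine HasSep.of_dvd hγ ?_ ?_ hd (hasSep_swapIdeal.2 hi₀)
      · rwa [mem_swapIdeal, Bivariate.swap_map_C]
      · rwa [← originEval_swap, Bivariate.swap_map_C]
    · refine hasSep_of_diff_eq_zero hKX hj₀ hi₀ fun i j hi hj => ?_
      have h1 := h i j (by omega) (by omega)
      rw [ZeroDimScheme.ΔM, diffHilbert] at h1
      rw [← hMX, ← hMX, ← hMX, ← hMX]
      push_cast
      simp only [add_sub_cancel_right]
      linarith
  have hiff : ∀ i j, HasSep K i j ↔ q + 1 ≤ i ∧ p + 1 ≤ j := fun i j =>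
    ⟨fun hs => ⟨hlow₂ j i (hasSep_swapIdeal.2 hs), hlow₁ i j hs⟩, fun hs => hsep.mono hs.1 hs.2⟩
  refine ⟨fun i j => ?_, fun i j => ?_⟩
  · rw [← hψ.hasSep_iff X P hsupp hP0, hiff]
    omega
  · by_cases hij : 0 ≤ i ∧ 0 ≤ j
    · obtain ⟨i, rfl⟩ := Int.eq_ofNat_of_zero_le hij.1
      obtain ⟨j, rfl⟩ := Int.eq_ofNat_of_zero_le hij.2
      have h1 := hMX (i + 1) (j + 1)
      have h2 := hMZ (i + 1) (j + 1)
      rw [boxHilbert_inf_origin hKX] at h1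
      push_cast at h1 h2
      simp only [add_sub_cancel_right] at h1 h2
      rw [ZeroDimScheme.M, ZeroDimScheme.M, h1, h2]
      congr 1
      refine if_congr ?_ rfl rfl
      rw [hiff]
      omega
    · rw [ZeroDimScheme.M, ZeroDimScheme.M, hilbert, hilbert, if_neg hij, if_neg hij,
        if_neg (by omega), add_zero]

theorem separator_unique [IsAlgClosed k] {X : ZeroDimScheme k} {P : Point k}
    (hPX : P ∈ support X.ideal) (hP : multiplicity X.ideal P = 1) {i j : ℕ} {f g : S k}
    (hf : X.IsSeparator P i j f) (hg : X.IsSeparator P i j g) :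
    ∃ c : k, c ≠ 0 ∧ f - c • g ∈ X.ideal := by
  obtain ⟨hf, hfP, hfc⟩ := hf
  obtain ⟨hg, hgP, hgc⟩ := hg
  rw [mem_pointIdeal_iff hf] at hfP
  rw [mem_pointIdeal_iff hg] at hgP
  refine ⟨evalAt P f / evalAt P g, div_ne_zero hfP hgP, ?_⟩
  have hm : f - (evalAt P f / evalAt P g) • g ∈ bigrading k (i, j) :=
    sub_mem hf (Submodule.smul_mem _ _ hg)
  rw [mem_ideal_iff_of_multiplicity_one hPX hP hm, mem_pointIdeal_iff hm]
  constructor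
  · rw [MvPolynomial.smul_eq_C_mul]
    exact sub_mem (mem_eraseIdeal.2 hfc) (Ideal.mul_mem_left _ _ (mem_eraseIdeal.2 hgc))
  · rw [map_sub, map_smul, smul_eq_mul, div_mul_cancel₀ _ hgP, sub_self]

end

end BiProj

end

theorem mainTheorem2 {k : Type*} [Field k] [IsAlgClosed k]
    (X : BiProj.ZeroDimScheme k) (P : BiProj.Point k)
    (hPX : P ∈ BiProj.support X.ideal) (hP : BiProj.multiplicity X.ideal P = 1)
    -- `R` and `C` are equations of the `(1,0)`-line and of the `(0,1)`-line through `P`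
    (R C : BiProj.S k)
    (hR : R ∈ BiProj.bigrading k (1, 0)) (hR0 : R ≠ 0) (hRP : R ∈ BiProj.pointIdeal P)
    (hC : C ∈ BiProj.bigrading k (0, 1)) (hC0 : C ≠ 0) (hCP : C ∈ BiProj.pointIdeal P)
    (Z : BiProj.ZeroDimScheme k) (hZ : Z = X.erase P)
    (p q : ℕ) (hp : p = BiProj.numOnLine Z.ideal R) (hq : q = BiProj.numOnLine Z.ideal C)
    (h : (p : ℤ) = X.b ∨ (q : ℤ) = X.a ∨
      ((p : ℤ) < X.b ∧ (q : ℤ) < X.a ∧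
        ∀ i j : ℤ, (q : ℤ) + 1 ≤ i → (p : ℤ) + 1 ≤ j → X.ΔM i j = 0)) :
    (∀ i j : ℤ, (i, j) ≠ ((q : ℤ), (p : ℤ)) → Z.ΔM i j = X.ΔM i j) ∧
    Z.ΔM q p = X.ΔM q p - 1 ∧
    -- there is a separator of bidegree `(q, p)`
    (∃ f, X.IsSeparator P q p f) ∧
    -- every separator has bidegree at least `(q, p)`
    (∀ (i j : ℕ) (f : BiProj.S k), X.IsSeparator P i j f → q ≤ i ∧ p ≤ j) ∧
    -- up to a nonzero scalar and modulo `I(X)`, the separator of bidegree `(q, p)` is unique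
    (∀ f g : BiProj.S k, X.IsSeparator P q p f → X.IsSeparator P q p g →
      ∃ c : k, c ≠ 0 ∧ f - c • g ∈ X.ideal) := by
  subst hZ
  obtain ⟨hsep, hM⟩ := BiProj.exists_separator_iff X P hPX hP R C hR hR0 hRP hC hC0 hCP p q hp hq
    (h.imp_right (Or.imp_right fun h => h.2.2))
  -- The mixed difference of the indicator of a quadrant is the indicator of its corner.
  have hΔ : ∀ i j : ℤ, X.ΔM i j = (X.erase P).ΔM i j +
      if i = q ∧ j = p then 1 else 0 := by
    intro i j
    have h1 := hM i j
    have h2 := hM (i - 1) j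
    have h3 := hM i (j - 1)
    have h4 := hM (i - 1) (j - 1)
    simp only [BiProj.ZeroDimScheme.M] at h1 h2 h3 h4
    rw [BiProj.ZeroDimScheme.ΔM, BiProj.ZeroDimScheme.ΔM, BiProj.diffHilbert, BiProj.diffHilbert,
      h1, h2, h3, h4]
    split_ifs <;> omega
  refine ⟨fun i j hij => ?_, ?_, (hsep q p).2 ⟨le_rfl, le_rfl⟩,
    fun i j f hf => (hsep i j).1 ⟨f, hf⟩, fun f g hf hg => BiProj.separator_unique hPX hP hf hg⟩
  · rw [hΔ, if_neg fun h => hij (Prod.ext h.1 h.2), add_zero]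
  · rw [hΔ, if_pos ⟨rfl, rfl⟩, add_sub_cancel_right]
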